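/- Let $0<d<\pi/2$ and let $\mathscr{D}_d=\{\zeta\in\mathbb{C}:|\operatorname{Im}\zeta|<d\}$. Let $\psi(\zeta)=\log(1+\mathrm{e}^{\pi\sinh\zeta})$, where the logarithm is the branch that is analytic on the strip $|\operatorname{Im}\zeta|<\pi/2$ and real on the real line. Let $f$ be analytic in $\psi(\mathscr{D}_d)$, and assume that there are constants $K>0$, $\beta>0$ and $0<\alpha\le 1$ with $$|f(z)|\le K\left|\left(\frac{z}{1+z}\right)^{\alpha-1}\mathrm{e}^{-\beta z}\right|\qquad\text{for all } z\in\psi(\mathscr{D}_d)$$ (for $z=-1$ the power is read as $0$ if $\alpha<1$ and as $1$ if $\alpha=1$). Put $\mu=\min\{\alpha,\beta\}$ and $\nu=\max\{\alpha,\beta\}$. For $\gamma>0$ let $$x_\gamma=\begin{cases}\operatorname{arcsinh}\left(\dfrac{\sqrt{1+\sqrt{1-(2\pi\gamma)^2}}}{2\pi\gamma}\right)&\text{if }0<\gamma<1/(2\pi),\\[2ex]\operatorname{arcsinh}(1)&\text{if }\gamma\ge 1/(2\pi).\end{cases}$$ Then $f$ is integrable on $(0,\infty)$. Moreover, let $n$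 be a natural number, let $h=\log(4dn/\mu)/n$, and let $$\begin{cases}M=n,\quad N=n-\lfloor\log(\beta/\alpha)/h\rfloor&\text{if }\mu=\alpha,\\ N=n,\quad M=n-\lfloor\log(\alpha/\beta)/h\rfloor&\text{if }\mu=\beta.\end{cases}$$ If $n$ is sufficiently large, in the sense that $n\ge \nu\mathrm{e}/(4d)$, $Mh\ge x_\alpha$ and $Nh\ge x_\beta$, then $$\left|\int_0^\infty f(t)\,\mathrm{d}t-h\sum_{k=-M}^{N}f(\psi(kh))\,\psi'(kh)\right|\le C_{3\ddagger}\,\mathrm{e}^{-2\pi dn/\log(4dn/\mu)},$$ where $C_{3\ddagger}$ is the constant, independent of $n$, $$C_{3\ddagger}=\frac{2K}{\mu}\left\{\frac{2\,(\tilde c_d)^{1-\alpha}}{(1-\mathrm{e}^{-\pi\mu\mathrm{e}/2})\{\cos(\frac{\pi}{2}\sin d)\}^{\alpha+\beta}\cos d}+\mathrm{e}^{\pi(1-\alpha+6\nu)/12}\right\},$$ $$\tilde c_d=\frac{1+\log(1+c_d)}{\log(1+c_d)}\,c_d,\qquad c_d=1+\frac{1}{\cos(\frac{\pi}{2}\sin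 d)}.$$ This rate is better than the rates $\mathrm{e}^{-2\pi dn/\log(8dn/\mu)}$ and $\mathrm{e}^{-2\pi dn/\log(2\pi dn/\mu)}$ of the earlier DE transformations for this case: for the same $d$ and $\mu$, as $n\to\infty$, $$\mathrm{e}^{-2\pi dn/\log(4dn/\mu)}=o\!\left(\mathrm{e}^{-2\pi dn/\log(cdn/\mu)}\right)\qquad\text{for } c=8\text{ and } c=2\pi.$$ -/

import Mathlib

open Asymptotics

noncomputable section

namespace SincDE

/-- The strip `𝒟_d = {ζ : |Im ζ| < d}`. -/
def strip (d : ℝ) : Set ℂ := {ζ | |ζ.im| < d}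

/-- The analytic branch of `log (1 + exp w)` on the plane cut along `{i t : |t| ≥ π}` that is real
for real `w`. For `Re w ≤ 0` it is the principal logarithm of `1 + exp w`; for `Re w > 0` it is
`w` plus the principal logarithm of `1 + exp (-w)`. (The principal logarithm of `1 + exp w` itself
jumps when `1 + exp w` crosses the negative real axis.) -/
def logOneAddExp (w : ℂ) : ℂ :=
  if w.re ≤ 0 then Complex.log (1 + Complex.exp w)
  else w + Complex.log (1 + Complex.exp (-w))

/-- The transformation `ψ(ζ) = log (1 + exp (π sinh ζ))`: on the strip `|Im ζ| < π / 2` it is the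
analytic branch that is real on the real line, see `exp_psi`, `psi_ofReal`,
`differentiableOn_psi`. -/
def psi (ζ : ℂ) : ℂ := logOneAddExp (Real.pi * Complex.sinh ζ)

/-- `E₃(z; α, β) = (z / (1 + z)) ^ (α - 1) * exp (-β z)`. Only its modulus is used, and the modulus
of a real power does not depend on the branch. At `z = -1` (where `z / (1 + z)` is `0` in Lean) the
value of the first factor is `0` for `α < 1` and `1` for `α = 1`, in agreement with
`((1 + z) / z) ^ (1 - α)`. -/
def E3 (α β : ℝ) (z : ℂ) : ℂ :=
  (z / (1 + z)) ^ ((α - 1 : ℝ) : ℂ) * Complex.exp (-(β : ℂ) * z)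

/-- The threshold `x_γ`, for `γ > 0`. -/
def xThreshold (γ : ℝ) : ℝ :=
  if γ < 1 / (2 * Real.pi) then
    Real.arsinh (Real.sqrt (1 + Real.sqrt (1 - (2 * Real.pi * γ) ^ 2)) / (2 * Real.pi * γ))
  else Real.arsinh 1

/-- The mesh size `h = log (4 d n / μ) / n`. -/
def mesh (d μ : ℝ) (n : ℕ) : ℝ := Real.log (4 * d * n / μ) / n

/-- The lower truncation number `M`: `n` if `min α β = α`, and `n - ⌊log (α / β) / h⌋` otherwise. -/
def lowerNum (α β h : ℝ) (n : ℕ) : ℤ :=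
  if min α β = α then n else n - ⌊Real.log (α / β) / h⌋

/-- The upper truncation number `N`: `n` if `min α β = β`, and `n - ⌊log (β / α) / h⌋` otherwise. -/
def upperNum (α β h : ℝ) (n : ℕ) : ℤ :=
  if min α β = β then n else n - ⌊Real.log (β / α) / h⌋

/-- `c_d = 1 + 1 / cos ((π / 2) sin d)`. -/
def cConst (d : ℝ) : ℝ := 1 + 1 / Real.cos (Real.pi / 2 * Real.sin d)

/-- `c̃_d = (1 + log (1 + c_d)) / log (1 + c_d) * c_d`. -/
def cTilde (d : ℝ) : ℝ :=
  (1 + Real.log (1 + cConst d)) / Real.log (1 + cConst d) * cConst d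

/-- The explicit constant of the error bound. -/
def errorConst (K α β d : ℝ) : ℝ :=
  2 * K / min α β *
    (2 * cTilde d ^ (1 - α) /
        ((1 - Real.exp (-(Real.pi * min α β * Real.exp 1 / 2))) *
          Real.cos (Real.pi / 2 * Real.sin d) ^ (α + β) * Real.cos d) +
      Real.exp (Real.pi * (1 - α + 6 * max α β) / 12))

/-! The following facts show that `psi` is the branch it is said to be. -/

theorem one_add_exp_mem_slitPlane_of_re_neg {w : ℂ} (hw : w.re < 0) :
    1 + Complex.exp w ∈ Complex.slitPlane := by
  left
  have h1 : |(Complex.exp w).re| ≤ ‖Complex.exp w‖ := Complex.abs_re_le_norm _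
  rw [Complex.norm_exp] at h1
  have h2 : Real.exp w.re < 1 := by simpa using hw
  have h3 := neg_abs_le (Complex.exp w).re
  simp only [Complex.add_re, Complex.one_re]
  linarith

theorem one_add_exp_mem_slitPlane_of_im {w : ℂ} (hw : |w.im| < Real.pi) :
    1 + Complex.exp w ∈ Complex.slitPlane := by
  by_cases h : w.im = 0
  · left
    simp only [Complex.add_re, Complex.one_re, Complex.exp_re, h, Real.cos_zero, mul_one]
    positivity
  · right
    simp only [Complex.add_im, Complex.one_im, Complex.exp_im, zero_add]
    refine mul_ne_zero (Real.exp_pos _).ne' ?_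
    intro h0
    obtain ⟨h1, h2⟩ := abs_lt.1 hw
    exact h ((Real.sin_eq_zero_iff_of_lt_of_lt h1 h2).1 h0)

theorem logOneAddExp_aux {w : ℂ} (hre : 0 < w.re) (him : |w.im| < Real.pi) :
    w + Complex.log (1 + Complex.exp (-w)) = Complex.log (1 + Complex.exp w) := by
  have hs1 : 1 + Complex.exp (-w) ∈ Complex.slitPlane :=
    one_add_exp_mem_slitPlane_of_re_neg (by simpa using hre)
  have hs2 := one_add_exp_mem_slitPlane_of_im him
  have hexp : Complex.exp (w + Complex.log (1 + Complex.exp (-w))) =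
      Complex.exp (Complex.log (1 + Complex.exp w)) := by
    rw [Complex.exp_add, Complex.exp_log (Complex.slitPlane_ne_zero hs1),
      Complex.exp_log (Complex.slitPlane_ne_zero hs2), mul_add, ← Complex.exp_add]
    simp [add_comm]
  obtain ⟨k, hk⟩ := Complex.exp_eq_exp_iff_exists_int.1 hexp
  have him' := congrArg Complex.im hk
  have hrepos : 0 < (1 + Complex.exp (-w)).re := by
    have h1 : |(Complex.exp (-w)).re| ≤ ‖Complex.exp (-w)‖ := Complex.abs_re_le_norm _
    rw [Complex.norm_exp] at h1
    have h2 : Real.exp (-w).re < 1 := by simpa using hre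
    have h3 := neg_abs_le (Complex.exp (-w)).re
    simp only [Complex.add_re, Complex.one_re]
    linarith
  have harg := abs_lt.1 (Complex.abs_arg_lt_pi_div_two_iff.2 (Or.inl hrepos))
  have hB1 := Complex.neg_pi_lt_arg (1 + Complex.exp w)
  have hB2 := Complex.arg_le_pi (1 + Complex.exp w)
  have e : (k * (2 * (Real.pi : ℂ) * Complex.I)).im = k * (2 * Real.pi) := by
    simp
  rw [Complex.add_im, Complex.add_im, e, Complex.log_im, Complex.log_im] at him'
  obtain ⟨l1, l2⟩ := abs_lt.1 him
  have hpi := Real.pi_pos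
  have himA : (1 + Complex.exp (-w)).im = -(Real.exp (-w.re) * Real.sin w.im) := by
    simp [Complex.exp_im]
  have himB : (1 + Complex.exp w).im = Real.exp w.re * Real.sin w.im := by
    simp [Complex.exp_im]
  have hk0 : k = 0 := by
    have key : |(k : ℝ) * (2 * Real.pi)| < 2 * Real.pi := by
      rcases le_total 0 w.im with h0 | h0
      · have hsin : 0 ≤ Real.sin w.im := Real.sin_nonneg_of_nonneg_of_le_pi h0 l2.le
        have hb : 0 ≤ Complex.arg (1 + Complex.exp w) := by
          rw [Complex.arg_nonneg_iff, himB]; positivity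
        have ha : Complex.arg (1 + Complex.exp (-w)) ≤ Real.pi / 2 := harg.2.le
        rw [abs_lt]
        constructor <;> linarith [harg.1]
      · have hsin : Real.sin w.im ≤ 0 := Real.sin_nonpos_of_nonpos_of_neg_pi_le h0 l1.le
        have hb : Complex.arg (1 + Complex.exp w) ≤ 0 := by
          rcases h0.lt_or_eq with h0' | h0'
          · have : Real.sin w.im < 0 := Real.sin_neg_of_neg_of_neg_pi_lt h0' l1
            refine (Complex.arg_neg_iff.2 ?_).le
            rw [himB]
            exact mul_neg_of_pos_of_neg (Real.exp_pos _) this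
          · refine le_of_eq (Complex.arg_eq_zero_iff.2 ⟨?_, ?_⟩)
            · simp only [Complex.add_re, Complex.one_re, Complex.exp_re, h0', Real.cos_zero]
              positivity
            · rw [himB, h0']; simp
        rw [abs_lt]
        constructor <;> linarith [harg.2, harg.1]
    rw [abs_mul, abs_of_pos (by positivity : (0 : ℝ) < 2 * Real.pi)] at key
    have h1 : |(k : ℝ)| < 1 := by
      by_contra hcon
      push Not at hcon
      nlinarith
    have h2 : |k| < 1 := by exact_mod_cast h1
    exact Int.abs_lt_one_iff.1 h2
  rw [hk, hk0]
  simp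

theorem pi_mul_sinh_re_im (ζ : ℂ) :
    ((Real.pi : ℂ) * Complex.sinh ζ).re = Real.pi * (Real.sinh ζ.re * Real.cos ζ.im) ∧
    ((Real.pi : ℂ) * Complex.sinh ζ).im = Real.pi * (Real.cosh ζ.re * Real.sin ζ.im) := by
  have h : Complex.sinh ζ = ((Real.sinh ζ.re * Real.cos ζ.im : ℝ) : ℂ) +
      ((Real.cosh ζ.re * Real.sin ζ.im : ℝ) : ℂ) * Complex.I := by
    conv_lhs => rw [← Complex.re_add_im ζ]
    rw [Complex.sinh_add, Complex.cosh_mul_I, Complex.sinh_mul_I]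
    push_cast
    ring
  rw [h]
  constructor
  · rw [Complex.re_ofReal_mul, Complex.add_re, Complex.ofReal_re, Complex.re_ofReal_mul]
    simp
  · rw [Complex.im_ofReal_mul, Complex.add_im, Complex.ofReal_im, Complex.im_ofReal_mul]
    simp

theorem pi_mul_sinh_cut {ζ : ℂ} (hζ : ζ ∈ strip (Real.pi / 2)) :
    ((Real.pi : ℂ) * Complex.sinh ζ).re ≠ 0 ∨
      |((Real.pi : ℂ) * Complex.sinh ζ).im| < Real.pi := by
  obtain ⟨h1, h2⟩ := abs_lt.1 (show |ζ.im| < Real.pi / 2 from hζ)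
  have hcos : 0 < Real.cos ζ.im := Real.cos_pos_of_mem_Ioo ⟨h1, h2⟩
  rw [(pi_mul_sinh_re_im ζ).1, (pi_mul_sinh_re_im ζ).2]
  by_cases h : ζ.re = 0
  · right
    rw [h, Real.cosh_zero, one_mul, abs_mul, abs_of_pos Real.pi_pos]
    have : |Real.sin ζ.im| < 1 := by
      rw [← sq_lt_one_iff_abs_lt_one]
      nlinarith [Real.sin_sq_add_cos_sq ζ.im]
    nlinarith [Real.pi_pos]
  · left
    exact mul_ne_zero Real.pi_pos.ne' (mul_ne_zero (by simpa [Real.sinh_eq_zero] using h) hcos.ne')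

theorem one_add_exp_ne_zero {w : ℂ} (hw : w.re ≠ 0 ∨ |w.im| < Real.pi) :
    1 + Complex.exp w ≠ 0 := by
  rcases hw with h | h
  · intro h0
    have h1 : Complex.exp w = -1 := by linear_combination h0
    have h2 : Real.exp w.re = 1 := by rw [← Complex.norm_exp, h1]; simp
    exact h (by simpa using h2)
  · exact Complex.slitPlane_ne_zero (one_add_exp_mem_slitPlane_of_im h)

/-- `psi` is a logarithm of `1 + exp (π sinh ζ)` on the strip `|Im ζ| < π / 2`. -/
theorem exp_psi {ζ : ℂ} (hζ : ζ ∈ strip (Real.pi / 2)) :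
    Complex.exp (psi ζ) = 1 + Complex.exp (Real.pi * Complex.sinh ζ) := by
  have hne := one_add_exp_ne_zero (pi_mul_sinh_cut hζ)
  unfold psi logOneAddExp
  split_ifs with h
  · exact Complex.exp_log hne
  · rw [Complex.exp_add, Complex.exp_log, mul_add, ← Complex.exp_add]
    · simp [add_comm]
    · refine one_add_exp_ne_zero (Or.inl ?_)
      simpa using (not_le.1 h).ne'

/-- On the real line `psi` is the real function `log (1 + exp (π sinh t))`. -/
theorem psi_ofReal (t : ℝ) :
    psi t = ((Real.log (1 + Real.exp (Real.pi * Real.sinh t)) : ℝ) : ℂ) := by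
  have h0 : (Real.pi : ℂ) * Complex.sinh (t : ℂ) = ((Real.pi * Real.sinh t : ℝ) : ℂ) := by
    push_cast
    rfl
  have h1 : psi t = Complex.log (1 + Complex.exp (Real.pi * Complex.sinh t)) := by
    unfold psi logOneAddExp
    split_ifs with h
    · rfl
    · refine logOneAddExp_aux (not_le.1 h) ?_
      rw [h0, Complex.ofReal_im]
      simpa using Real.pi_pos
  rw [h1, h0, Complex.ofReal_log (by positivity)]
  push_cast
  rfl

/-- `psi` is holomorphic on the strip `|Im ζ| < π / 2`. -/
theorem differentiableOn_psi : DifferentiableOn ℂ psi (strip (Real.pi / 2)) := by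
  intro ζ hζ
  refine DifferentiableAt.differentiableWithinAt ?_
  have hin : DifferentiableAt ℂ (fun ζ : ℂ => (Real.pi : ℂ) * Complex.sinh ζ) ζ := by fun_prop
  refine DifferentiableAt.comp (g := logOneAddExp) ζ ?_ hin
  have hcut := pi_mul_sinh_cut hζ
  generalize (Real.pi : ℂ) * Complex.sinh ζ = w at hcut
  have A : 1 + Complex.exp w ∈ Complex.slitPlane →
      DifferentiableAt ℂ (fun w => Complex.log (1 + Complex.exp w)) w := fun h =>
    DifferentiableAt.clog (by fun_prop) h
  by_cases him : |w.im| < Real.pi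
  · refine (A (one_add_exp_mem_slitPlane_of_im him)).congr_of_eventuallyEq ?_
    have : ∀ᶠ v : ℂ in nhds w, |v.im| < Real.pi :=
      (Complex.continuous_im.abs).continuousAt.eventually_lt continuousAt_const him
    filter_upwards [this] with v hv
    unfold logOneAddExp
    split_ifs with h
    · rfl
    · exact logOneAddExp_aux (not_le.1 h) hv
  · have hre : w.re ≠ 0 := hcut.resolve_right him
    rcases lt_or_gt_of_ne hre with h | h
    · refine (A (one_add_exp_mem_slitPlane_of_re_neg h)).congr_of_eventuallyEq ?_
      have : ∀ᶠ v : ℂ in nhds w, v.re < 0 :=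
        Complex.continuous_re.continuousAt.eventually_lt continuousAt_const h
      filter_upwards [this] with v hv
      simp [logOneAddExp, hv.le]
    · have hs : 1 + Complex.exp (-w) ∈ Complex.slitPlane :=
        one_add_exp_mem_slitPlane_of_re_neg (by simpa using h)
      have B : DifferentiableAt ℂ (fun w => w + Complex.log (1 + Complex.exp (-w))) w :=
        differentiableAt_id.add (DifferentiableAt.clog (by fun_prop) hs)
      refine B.congr_of_eventuallyEq ?_
      have : ∀ᶠ v : ℂ in nhds w, 0 < v.re :=
        continuousAt_const.eventually_lt Complex.continuous_re.continuousAt h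
      filter_upwards [this] with v hv
      simp [logOneAddExp, not_le.2 hv]

end SincDE

end

/-!
The substitution `t = ψ x` turns `∫₀^∞ f` into `∫ F` over the real line, where
`F ζ = f (ψ ζ) ψ'(ζ)`. With `w = π sinh ζ`, the inequality
`|1 + exp w| ≥ cos ((π / 2) sin d) (1 + exp (Re w))` makes `F` decay double exponentially, uniformly
in the strip. Shifting the Fourier integral of `F` to the lines `Im ζ = ± η` and letting `η → d`
gives `‖𝓕 F (ξ)‖ = O(exp (-2 π d |ξ|))`, so by Poisson summation the infinite trapezoidal sum errs
by `O(exp (-2 π d / h))`.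

The two discarded tails are dominated by sums of `cosh x · exp (-π γ sinh x)` with `γ = α` on the
left and `γ = β` on the right, hence by integrals of this function where it decreases; the
thresholds `x_γ` limit what is lost where it may still increase. The choice of `h`, `M` and `N`
gives both kinds of error the order `exp (-2 π d n / log (4 d n / μ))`.
-/

namespace SincDE

open MeasureTheory Filter Topology

section Trigonometry

open Real

theorem mul_cos_le_mul_sin {A : ℝ} (h0 : 0 ≤ A) (h1 : A ≤ π / 2) :
    A * cos A ≤ ((π / 2) ^ 2 - A ^ 2) * sin A := by
  have hcos : cos A ≤ π / 2 - A := by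
    rw [← sin_pi_div_two_sub]
    exact sin_le (by linarith)
  have hsin : A ≤ (π / 2 + A) * sin A :=
    calc A ≤ A + 2 / π * A ^ 2 := le_add_of_nonneg_right (by positivity)
      _ = (π / 2 + A) * (2 / π * A) := by field_simp
      _ ≤ (π / 2 + A) * sin A := by gcongr; exact mul_le_sin h0 h1
  calc A * cos A ≤ A * (π / 2 - A) := by gcongr
    _ ≤ ((π / 2 + A) * sin A) * (π / 2 - A) := by gcongr
    _ = ((π / 2) ^ 2 - A ^ 2) * sin A := by ring

theorem one_add_sq_div_two_le_cosh (t : ℝ) : 1 + t ^ 2 / 2 ≤ cosh t := by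
  have hcosh : cosh t = 1 + 2 * sinh (t / 2) ^ 2 := by
    have h := cosh_two_mul (t / 2)
    rw [mul_div_cancel₀ t two_ne_zero, cosh_sq] at h
    linarith
  have hsinh : (t / 2) ^ 2 ≤ sinh (t / 2) ^ 2 := by
    rw [sq_le_sq, abs_sinh]
    exact self_le_sinh_iff.2 (abs_nonneg _)
  linarith

theorem abs_sin_add_le {A t : ℝ} (hs : 0 ≤ sin A) (hc : 0 ≤ cos A) (ht : 0 ≤ t) :
    |sin (A + t)| ≤ sin A + cos A * t :=
  calc |sin (A + t)| ≤ |sin A * cos t| + |cos A * sin t| := by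
        rw [sin_add]
        exact abs_add_le _ _
    _ = sin A * |cos t| + cos A * |sin t| := by
        rw [abs_mul, abs_mul, abs_of_nonneg hs, abs_of_nonneg hc]
    _ ≤ sin A * 1 + cos A * t := by
        gcongr
        · exact abs_cos_le_one t
        · exact abs_sin_le_abs.trans_eq (abs_of_nonneg ht)
    _ = sin A + cos A * t := by rw [mul_one]

-- For `A = (π / 2) sin y` and `B = (π / 2) cos y` this says that the ratio of `|1 + exp w|` to
-- `1 + exp (Re w)`, where `w = π sinh (x + i y)`, is smallest at `x = 0`.
theorem abs_sin_mul_cosh_le {A B : ℝ} (hAB : A ^ 2 + B ^ 2 = (π / 2) ^ 2) (x : ℝ) :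
    |sin (A * cosh x)| ≤ |sin A| * cosh (B * sinh x) := by
  wlog hA : 0 ≤ A generalizing A
  · simpa using this (A := -A) (by simpa using hAB) (by linarith)
  have hA2 : A ≤ π / 2 := abs_le_of_sq_le_sq' (by nlinarith) (by positivity) |>.2
  have hs : 0 ≤ sin A := sin_nonneg_of_nonneg_of_le_pi hA (by linarith)
  have hc : 0 ≤ cos A := cos_nonneg_of_mem_Icc ⟨by linarith, hA2⟩
  have hx : 0 ≤ cosh x - 1 := sub_nonneg.2 (one_le_cosh x)
  have hB : A * cos A ≤ B ^ 2 * sin A := by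
    simpa only [← hAB, add_sub_cancel_left] using mul_cos_le_mul_sin hA hA2
  have hcosh : 1 + B ^ 2 * (cosh x - 1) ≤ cosh (B * sinh x) := by
    refine le_trans ?_ (one_add_sq_div_two_le_cosh _)
    rw [mul_pow, sinh_sq]
    nlinarith [mul_nonneg (sq_nonneg B) (sq_nonneg (cosh x - 1))]
  calc |sin (A * cosh x)| = |sin (A + A * (cosh x - 1))| := by ring_nf
    _ ≤ sin A + cos A * (A * (cosh x - 1)) := abs_sin_add_le hs hc (by positivity)
    _ = sin A + A * cos A * (cosh x - 1) := by ring
    _ ≤ sin A + B ^ 2 * sin A * (cosh x - 1) := by gcongr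
    _ = sin A * (1 + B ^ 2 * (cosh x - 1)) := by ring
    _ ≤ |sin A| * cosh (B * sinh x) := by gcongr; exact le_abs_self _

theorem abs_sin_le_sin {y d : ℝ} (hy : |y| ≤ d) (hd : d ≤ π / 2) : |sin y| ≤ sin d := by
  have := pi_pos
  rw [abs_sin_eq_sin_abs_of_abs_le_pi (by linarith)]
  exact sin_le_sin_of_le_of_le_pi_div_two (by linarith [abs_nonneg y]) hd hy

theorem abs_sin_lt_one {y : ℝ} (hy : |y| < π / 2) : |sin y| < 1 := by
  have hcos : 0 < cos y := cos_pos_of_mem_Ioo (abs_lt.1 hy)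
  rw [← sq_lt_one_iff_abs_lt_one]
  nlinarith [sin_sq_add_cos_sq y]

theorem cos_pi_div_two_mul_sin_pos {y : ℝ} (hy : |y| < π / 2) : 0 < cos (π / 2 * sin y) := by
  refine cos_pos_of_mem_Ioo (abs_lt.1 ?_)
  rw [abs_mul, abs_of_pos pi_div_two_pos]
  exact mul_lt_of_lt_one_right pi_div_two_pos (abs_sin_lt_one hy)

theorem cos_pi_div_two_mul_sin_anti {y d : ℝ} (hy : |y| ≤ d) (hd : d ≤ π / 2) :
    cos (π / 2 * sin d) ≤ cos (π / 2 * sin y) := by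
  have := pi_pos
  rw [← cos_abs (π / 2 * sin y), abs_mul, abs_of_pos pi_div_two_pos]
  refine cos_le_cos_of_nonneg_of_le_pi (by positivity) ?_ ?_
  · nlinarith [sin_le_one d]
  · gcongr
    exact abs_sin_le_sin hy hd

theorem one_add_exp_sq (s : ℝ) : (1 + exp s) ^ 2 = 4 * exp s * cosh (s / 2) ^ 2 := by
  have hmul : exp (s / 2) * exp (-(s / 2)) = 1 := by rw [← exp_add, add_neg_cancel, exp_zero]
  have hsq : exp s = exp (s / 2) ^ 2 := by rw [← exp_nat_mul]; ring_nf
  rw [cosh_eq, hsq]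
  linear_combination -(2 * exp (s / 2) ^ 2 + exp (s / 2) * exp (-(s / 2)) + 1) * hmul

theorem norm_one_add_exp_sq (w : ℂ) :
    ‖1 + Complex.exp w‖ ^ 2 = 4 * exp w.re * (cosh (w.re / 2) ^ 2 - sin (w.im / 2) ^ 2) := by
  have hcos : cos w.im = 1 - 2 * sin (w.im / 2) ^ 2 := by
    have h := cos_two_mul (w.im / 2)
    rw [mul_div_cancel₀ _ two_ne_zero, cos_sq'] at h
    linarith
  rw [mul_sub, ← one_add_exp_sq, ← Complex.normSq_eq_norm_sq, Complex.normSq_apply]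
  simp only [Complex.add_re, Complex.one_re, Complex.add_im, Complex.one_im, Complex.exp_re,
    Complex.exp_im, zero_add]
  linear_combination exp w.re ^ 2 * sin_sq_add_cos_sq w.im + 2 * exp w.re * hcos

theorem one_add_exp_mul_cos_le_norm (ζ : ℂ) :
    (1 + exp (π * Complex.sinh ζ).re) * cos (π / 2 * sin ζ.im) ≤
      ‖1 + Complex.exp (π * Complex.sinh ζ)‖ := by
  have hre : (π * Complex.sinh ζ).re / 2 = π / 2 * cos ζ.im * sinh ζ.re := by
    rw [(pi_mul_sinh_re_im ζ).1]; ring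
  have him : (π * Complex.sinh ζ).im / 2 = π / 2 * sin ζ.im * cosh ζ.re := by
    rw [(pi_mul_sinh_re_im ζ).2]; ring
  have hsin : sin ((π * Complex.sinh ζ).im / 2) ^ 2 ≤
      sin (π / 2 * sin ζ.im) ^ 2 * cosh ((π * Complex.sinh ζ).re / 2) ^ 2 := by
    have hpyth : (π / 2 * sin ζ.im) ^ 2 + (π / 2 * cos ζ.im) ^ 2 = (π / 2) ^ 2 := by
      rw [mul_pow, mul_pow, ← mul_add, sin_sq_add_cos_sq, mul_one]
    rw [← mul_pow, sq_le_sq, abs_mul, abs_of_pos (cosh_pos _), hre, him]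
    exact abs_sin_mul_cosh_le hpyth ζ.re
  refine le_of_sq_le_sq ?_ (norm_nonneg _)
  calc ((1 + exp (π * Complex.sinh ζ).re) * cos (π / 2 * sin ζ.im)) ^ 2
      = 4 * exp (π * Complex.sinh ζ).re * (cosh ((π * Complex.sinh ζ).re / 2) ^ 2 -
          sin (π / 2 * sin ζ.im) ^ 2 * cosh ((π * Complex.sinh ζ).re / 2) ^ 2) := by
        rw [mul_pow, one_add_exp_sq, cos_sq']
        ring
    _ ≤ ‖1 + Complex.exp (π * Complex.sinh ζ)‖ ^ 2 := by
        rw [norm_one_add_exp_sq]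
        gcongr

end Trigonometry

theorem isOpen_strip (d : ℝ) : IsOpen (strip d) :=
  isOpen_lt Complex.continuous_im.abs continuous_const

theorem strip_mono {d e : ℝ} (h : d ≤ e) : strip d ⊆ strip e :=
  fun _ hζ => lt_of_lt_of_le hζ h

theorem neg_mem_strip {d : ℝ} {ζ : ℂ} (hζ : ζ ∈ strip d) : -ζ ∈ strip d := by
  simpa [strip] using hζ

theorem ofReal_mem_strip {d : ℝ} (hd : 0 < d) (x : ℝ) : (x : ℂ) ∈ strip d := by
  simpa [strip] using hd

theorem abs_lt_of_mem_strip {d e : ℝ} (hd : d < e) {ζ : ℂ} (hζ : ζ ∈ strip d) : |d| < e := by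
  rwa [abs_of_pos ((abs_nonneg _).trans_lt hζ)]

section Transformation

theorem exp_neg_psi {ζ : ℂ} (hζ : ζ ∈ strip (Real.pi / 2)) :
    Complex.exp (-psi ζ) = (1 + Complex.exp (Real.pi * Complex.sinh ζ))⁻¹ := by
  rw [Complex.exp_neg, exp_psi hζ]

theorem one_sub_exp_neg_psi {ζ : ℂ} (hζ : ζ ∈ strip (Real.pi / 2)) :
    1 - Complex.exp (-psi ζ) = (1 + Complex.exp (Real.pi * Complex.sinh (-ζ)))⁻¹ := by
  have hne := one_add_exp_ne_zero (pi_mul_sinh_cut hζ)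
  have hne' := one_add_exp_ne_zero (pi_mul_sinh_cut (neg_mem_strip hζ))
  have hmul : Complex.exp (Real.pi * Complex.sinh ζ) *
      Complex.exp (Real.pi * Complex.sinh (-ζ)) = 1 := by
    rw [← Complex.exp_add, Complex.sinh_neg, mul_neg, add_neg_cancel, Complex.exp_zero]
  rw [exp_neg_psi hζ]
  field_simp
  linear_combination hmul

theorem one_sub_exp_neg_psi_ne_zero {ζ : ℂ} (hζ : ζ ∈ strip (Real.pi / 2)) :
    1 - Complex.exp (-psi ζ) ≠ 0 := by
  rw [one_sub_exp_neg_psi hζ]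
  exact inv_ne_zero (one_add_exp_ne_zero (pi_mul_sinh_cut (neg_mem_strip hζ)))

theorem psi_ne_zero {ζ : ℂ} (hζ : ζ ∈ strip (Real.pi / 2)) : psi ζ ≠ 0 := by
  intro h
  simpa [h] using one_sub_exp_neg_psi_ne_zero hζ

theorem deriv_psi {ζ : ℂ} (hζ : ζ ∈ strip (Real.pi / 2)) :
    deriv psi ζ = Real.pi * Complex.cosh ζ * (1 - Complex.exp (-psi ζ)) := by
  have hnhds := (isOpen_strip _).mem_nhds hζ
  have hleft := ((differentiableOn_psi ζ hζ).differentiableAt hnhds).hasDerivAt.cexp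
  have hright : HasDerivAt (fun z => 1 + Complex.exp (Real.pi * Complex.sinh z))
      (Complex.exp (Real.pi * Complex.sinh ζ) * (Real.pi * Complex.cosh ζ)) ζ :=
    (((Complex.hasDerivAt_sinh ζ).const_mul _).cexp).const_add 1
  have heq := hleft.unique (hright.congr_of_eventuallyEq (Filter.eventually_of_mem hnhds fun _ =>
    exp_psi))
  have hexp : Complex.exp (Real.pi * Complex.sinh ζ) = Complex.exp (psi ζ) - 1 := by
    rw [exp_psi hζ, add_sub_cancel_left]
  have hmul : Complex.exp (psi ζ) * Complex.exp (-psi ζ) = 1 := by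
    rw [← Complex.exp_add, add_neg_cancel, Complex.exp_zero]
  rw [hexp] at heq
  linear_combination Complex.exp (-psi ζ) * heq + (Real.pi * Complex.cosh ζ - deriv psi ζ) * hmul

theorem norm_exp_neg_psi_le {ζ : ℂ} (hζ : ζ ∈ strip (Real.pi / 2)) :
    ‖Complex.exp (-psi ζ)‖ ≤
      Real.sigmoid (-(Real.pi * Complex.sinh ζ).re) / Real.cos (Real.pi / 2 * Real.sin ζ.im) := by
  have hcos := cos_pi_div_two_mul_sin_pos hζ
  rw [exp_neg_psi hζ, norm_inv, Real.sigmoid_def, neg_neg, div_eq_mul_inv, ← mul_inv]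
  gcongr
  exact one_add_exp_mul_cos_le_norm ζ

theorem norm_one_sub_exp_neg_psi_le {ζ : ℂ} (hζ : ζ ∈ strip (Real.pi / 2)) :
    ‖1 - Complex.exp (-psi ζ)‖ ≤
      Real.sigmoid (Real.pi * Complex.sinh ζ).re / Real.cos (Real.pi / 2 * Real.sin ζ.im) := by
  have h := norm_exp_neg_psi_le (neg_mem_strip hζ)
  rw [exp_neg_psi (neg_mem_strip hζ), ← one_sub_exp_neg_psi hζ] at h
  simpa using h

theorem norm_one_sub_exp_neg_psi_le_cConst {d : ℝ} (hd : d < Real.pi / 2) {ζ : ℂ}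
    (hζ : ζ ∈ strip d) : ‖1 - Complex.exp (-psi ζ)‖ ≤ cConst d := by
  have hζ2 := strip_mono hd.le hζ
  have hcos := cos_pi_div_two_mul_sin_pos (abs_lt_of_mem_strip hd hζ)
  calc ‖1 - Complex.exp (-psi ζ)‖ ≤ 1 + ‖Complex.exp (-psi ζ)‖ := by
        simpa using norm_sub_le 1 (Complex.exp (-psi ζ))
    _ ≤ 1 + 1 / Real.cos (Real.pi / 2 * Real.sin d) := by
        gcongr
        refine (norm_exp_neg_psi_le hζ2).trans ?_
        gcongr
        · exact Real.sigmoid_le_one _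
        · exact cos_pi_div_two_mul_sin_anti (le_of_lt hζ) hd.le

end Transformation

section Sigmoid

theorem sigmoid_rpow_mul_sigmoid_neg_rpow_le {α β : ℝ} (hα : 0 ≤ α) (hβ : 0 ≤ β) (s : ℝ) :
    Real.sigmoid s ^ α * Real.sigmoid (-s) ^ β ≤ Real.exp (-(β * s)) := by
  have hα1 : Real.sigmoid s ^ α ≤ 1 :=
    Real.rpow_le_one (Real.sigmoid_nonneg s) (Real.sigmoid_le_one s) hα
  have hexp : Real.sigmoid (-s) ≤ Real.exp (-s) := by
    rw [← Real.sigmoid_mul_rexp_neg]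
    exact mul_le_of_le_one_left (Real.exp_pos _).le (Real.sigmoid_le_one s)
  calc Real.sigmoid s ^ α * Real.sigmoid (-s) ^ β ≤ 1 * Real.exp (-s) ^ β := by
        have := Real.sigmoid_nonneg (-s)
        gcongr
    _ = Real.exp (-(β * s)) := by rw [one_mul, ← Real.exp_mul]; ring_nf

theorem sigmoid_rpow_mul_sigmoid_neg_rpow_le_exp_mul {α β : ℝ} (hα : 0 ≤ α) (hβ : 0 ≤ β)
    (s : ℝ) : Real.sigmoid s ^ α * Real.sigmoid (-s) ^ β ≤ Real.exp (α * s) := by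
  simpa [mul_comm] using sigmoid_rpow_mul_sigmoid_neg_rpow_le hβ hα (-s)

theorem sigmoid_rpow_mul_sigmoid_neg_rpow_le_exp_abs {α β : ℝ} (hα : 0 ≤ α) (hβ : 0 ≤ β)
    (s : ℝ) : Real.sigmoid s ^ α * Real.sigmoid (-s) ^ β ≤ Real.exp (-(min α β * |s|)) := by
  rcases le_total 0 s with h | h
  · refine (sigmoid_rpow_mul_sigmoid_neg_rpow_le hα hβ s).trans ?_
    rw [abs_of_nonneg h]
    gcongr
    exact min_le_right _ _
  · refine (sigmoid_rpow_mul_sigmoid_neg_rpow_le_exp_mul hα hβ s).trans ?_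
    rw [abs_of_nonpos h, mul_neg, neg_neg]
    exact Real.exp_le_exp.2 (mul_le_mul_of_nonpos_right (min_le_left _ _) h)

end Sigmoid

section Integrand

theorem cConst_pos {d : ℝ} (hd : |d| < Real.pi / 2) : 0 < cConst d := by
  have := cos_pi_div_two_mul_sin_pos hd
  unfold cConst
  positivity

theorem cTilde_pos {d : ℝ} (hd : |d| < Real.pi / 2) : 0 < cTilde d := by
  have hc := cConst_pos hd
  have hlog := Real.log_pos (lt_add_of_pos_right 1 hc)
  unfold cTilde
  positivity

theorem norm_one_add_mul_norm_one_sub_exp_neg_le {c : ℝ} (hc : 0 < c) {z : ℂ}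
    (h : ‖1 - Complex.exp (-z)‖ ≤ c) :
    ‖1 + z‖ * ‖1 - Complex.exp (-z)‖ ≤
      (1 + Real.log (1 + c)) / Real.log (1 + c) * c * ‖z‖ := by
  have hρ : 0 < Real.log (1 + c) := Real.log_pos (by linarith)
  have hexpρ : Real.exp (Real.log (1 + c)) = 1 + c := Real.exp_log (by linarith)
  set ρ := Real.log (1 + c)
  have hz : ‖1 + z‖ ≤ 1 + ‖z‖ := by simpa using norm_add_le 1 z
  rcases le_total ρ ‖z‖ with hle | hle
  · have hfar : 1 + ‖z‖ ≤ (1 + ρ) / ρ * ‖z‖ := by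
      rw [div_mul_eq_mul_div, le_div_iff₀ hρ]
      linarith
    calc ‖1 + z‖ * ‖1 - Complex.exp (-z)‖ ≤ ((1 + ρ) / ρ * ‖z‖) * c := by
          gcongr
          exact hz.trans hfar
      _ = (1 + ρ) / ρ * c * ‖z‖ := by ring
  · have hexp : ‖1 - Complex.exp (-z)‖ ≤ Real.exp ‖z‖ - 1 := by
      rw [norm_sub_rev]
      simpa using Complex.norm_exp_sub_sum_le_exp_norm_sub_sum (-z) 1
    have hchord : Real.exp ‖z‖ - 1 ≤ ‖z‖ / ρ * c := by
      have hconv := convexOn_exp.2 (Set.mem_univ 0) (Set.mem_univ ρ)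
        (sub_nonneg.2 ((div_le_one hρ).2 hle)) (by positivity) (sub_add_cancel 1 (‖z‖ / ρ))
      simp only [smul_eq_mul, mul_zero, zero_add, Real.exp_zero, mul_one, hexpρ,
        div_mul_cancel₀ _ hρ.ne'] at hconv
      linarith
    calc ‖1 + z‖ * ‖1 - Complex.exp (-z)‖ ≤ (1 + ρ) * (‖z‖ / ρ * c) := by
          gcongr
          · exact hz.trans (by linarith)
          · exact hexp.trans hchord
      _ = (1 + ρ) / ρ * c * ‖z‖ := by ring

theorem norm_cosh_le (ζ : ℂ) : ‖Complex.cosh ζ‖ ≤ Real.cosh ζ.re := by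
  rw [Complex.cosh, Real.cosh_eq, norm_div, Complex.norm_two]
  gcongr
  refine (norm_add_le _ _).trans_eq ?_
  rw [Complex.norm_exp, Complex.norm_exp, Complex.neg_re]

theorem norm_E3 (α β : ℝ) (z : ℂ) :
    ‖E3 α β z‖ = (‖1 + z‖ / ‖z‖) ^ (1 - α) * ‖Complex.exp (-z)‖ ^ β := by
  rw [E3, norm_mul, Complex.norm_cpow_real, norm_div, Complex.norm_exp, Complex.norm_exp,
    ← Real.exp_mul, ← neg_sub 1 α, Real.rpow_neg (by positivity), ← Real.inv_rpow (by positivity),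
    inv_div]
  simp [mul_comm]

/-- The integrand `f (ψ ζ) ψ'(ζ)` obtained from `∫₀^∞ f` by the substitution `t = ψ x`. -/
noncomputable def deIntegrand (f : ℂ → ℂ) (ζ : ℂ) : ℂ := f (psi ζ) * deriv psi ζ

/-- The double exponentially decaying function `x ↦ cosh x · exp (-a sinh x)`; it is the derivative
of `-exp (-a sinh x) / a`. -/
noncomputable def deDecay (a x : ℝ) : ℝ := Real.cosh x * Real.exp (-(a * Real.sinh x))

variable {f : ℂ → ℂ} {K α β κ d : ℝ}

theorem norm_deIntegrand_le_mul_norm_rpow (hK : 0 ≤ K) (hα1 : α ≤ 1) {ζ : ℂ}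
    (hζ : ζ ∈ strip (Real.pi / 2)) (hf : ‖f (psi ζ)‖ ≤ K * ‖E3 α β (psi ζ)‖)
    (hκ : ‖1 + psi ζ‖ * ‖1 - Complex.exp (-psi ζ)‖ ≤ κ * ‖psi ζ‖) :
    ‖deIntegrand f ζ‖ ≤ K * κ ^ (1 - α) *
      (‖1 - Complex.exp (-psi ζ)‖ ^ α * ‖Complex.exp (-psi ζ)‖ ^ β) *
        (Real.pi * Real.cosh ζ.re) := by
  have hz : 0 < ‖psi ζ‖ := norm_pos_iff.2 (psi_ne_zero hζ)
  have hq : 0 < ‖1 - Complex.exp (-psi ζ)‖ := norm_pos_iff.2 (one_sub_exp_neg_psi_ne_zero hζ)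
  rw [norm_E3] at hf
  rw [deIntegrand, deriv_psi hζ, norm_mul, norm_mul, norm_mul, Complex.norm_real,
    Real.norm_of_nonneg Real.pi_pos.le]
  set q := ‖1 - Complex.exp (-psi ζ)‖
  set r := ‖1 + psi ζ‖ / ‖psi ζ‖
  set p := ‖Complex.exp (-psi ζ)‖
  have hrq : r * q ≤ κ := by rwa [div_mul_eq_mul_div, div_le_iff₀ hz]
  have hsplit : q = q ^ (1 - α) * q ^ α := by rw [← Real.rpow_add hq, sub_add_cancel, Real.rpow_one]
  calc ‖f (psi ζ)‖ * (Real.pi * ‖Complex.cosh ζ‖ * q)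
      ≤ (K * (r ^ (1 - α) * p ^ β)) * (Real.pi * Real.cosh ζ.re * (q ^ (1 - α) * q ^ α)) := by
        rw [← hsplit]
        gcongr
        exact norm_cosh_le ζ
    _ = K * (r * q) ^ (1 - α) * (q ^ α * p ^ β) * (Real.pi * Real.cosh ζ.re) := by
        rw [Real.mul_rpow (by positivity) hq.le]
        ring
    _ ≤ K * κ ^ (1 - α) * (q ^ α * p ^ β) * (Real.pi * Real.cosh ζ.re) := by
        have := sub_nonneg.2 hα1
        gcongr

theorem norm_deIntegrand_le (hK : 0 ≤ K) (hα : 0 ≤ α) (hα1 : α ≤ 1) (hβ : 0 ≤ β) {ζ : ℂ}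
    (hζ : ζ ∈ strip (Real.pi / 2)) (hf : ‖f (psi ζ)‖ ≤ K * ‖E3 α β (psi ζ)‖)
    (hκ : ‖1 + psi ζ‖ * ‖1 - Complex.exp (-psi ζ)‖ ≤ κ * ‖psi ζ‖) :
    ‖deIntegrand f ζ‖ ≤ K * κ ^ (1 - α) / Real.cos (Real.pi / 2 * Real.sin ζ.im) ^ (α + β) *
      (Real.sigmoid (Real.pi * Complex.sinh ζ).re ^ α *
        Real.sigmoid (-(Real.pi * Complex.sinh ζ).re) ^ β) * (Real.pi * Real.cosh ζ.re) := by
  have hcos := cos_pi_div_two_mul_sin_pos hζ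
  have hκ0 : 0 ≤ κ := nonneg_of_mul_nonneg_left ((by positivity : (0 : ℝ) ≤ _).trans hκ)
    (norm_pos_iff.2 (psi_ne_zero hζ))
  have hp := norm_exp_neg_psi_le hζ
  have hq := norm_one_sub_exp_neg_psi_le hζ
  have hsp := Real.sigmoid_nonneg (Real.pi * Complex.sinh ζ).re
  have hsn := Real.sigmoid_nonneg (-(Real.pi * Complex.sinh ζ).re)
  refine (norm_deIntegrand_le_mul_norm_rpow hK hα1 hζ hf hκ).trans ?_
  set c := Real.cos (Real.pi / 2 * Real.sin ζ.im)
  set s := (Real.pi * Complex.sinh ζ).re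
  calc _ ≤ K * κ ^ (1 - α) * ((Real.sigmoid s / c) ^ α * (Real.sigmoid (-s) / c) ^ β) *
        (Real.pi * Real.cosh ζ.re) := by gcongr
    _ = _ := by
        rw [Real.div_rpow hsp hcos.le, Real.div_rpow hsn hcos.le, Real.rpow_add hcos]
        ring

theorem pi_mul_cos_mul_sinh_abs_re_le (hd : d < Real.pi / 2) {ζ : ℂ} (hζ : ζ ∈ strip d) :
    Real.pi * Real.cos d * Real.sinh |ζ.re| ≤ |(Real.pi * Complex.sinh ζ).re| := by
  have hcosd : 0 < Real.cos d := Real.cos_pos_of_mem_Ioo (abs_lt.1 (abs_lt_of_mem_strip hd hζ))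
  have hcos : Real.cos d ≤ Real.cos ζ.im := by
    rw [← Real.cos_abs ζ.im]
    exact Real.cos_le_cos_of_nonneg_of_le_pi (abs_nonneg _) (by linarith [Real.pi_pos])
      (le_of_lt hζ)
  rw [(pi_mul_sinh_re_im ζ).1, abs_mul, abs_mul, abs_of_pos Real.pi_pos,
    abs_of_pos (hcosd.trans_le hcos), ← Real.abs_sinh, mul_assoc, mul_comm (Real.cos d)]
  gcongr

theorem norm_deIntegrand_le_deDecay (hd : d < Real.pi / 2) (hK : 0 ≤ K) (hα : 0 ≤ α)
    (hα1 : α ≤ 1) (hβ : 0 ≤ β) {ζ : ℂ} (hζ : ζ ∈ strip d)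
    (hf : ‖f (psi ζ)‖ ≤ K * ‖E3 α β (psi ζ)‖) :
    ‖deIntegrand f ζ‖ ≤
      K * cTilde d ^ (1 - α) / Real.cos (Real.pi / 2 * Real.sin d) ^ (α + β) * Real.pi *
        deDecay (Real.pi * min α β * Real.cos d) |ζ.re| := by
  have hd' := abs_lt_of_mem_strip hd hζ
  have hc := cos_pi_div_two_mul_sin_pos hd'
  have hct := cTilde_pos hd'
  set s := (Real.pi * Complex.sinh ζ).re
  have hκ : ‖1 + psi ζ‖ * ‖1 - Complex.exp (-psi ζ)‖ ≤ cTilde d * ‖psi ζ‖ :=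
    norm_one_add_mul_norm_one_sub_exp_neg_le (cConst_pos hd')
      (norm_one_sub_exp_neg_psi_le_cConst hd hζ)
  have hsig0 : 0 ≤ Real.sigmoid s ^ α * Real.sigmoid (-s) ^ β :=
    mul_nonneg (Real.rpow_nonneg (Real.sigmoid_nonneg _) _)
      (Real.rpow_nonneg (Real.sigmoid_nonneg _) _)
  have hsig : Real.sigmoid s ^ α * Real.sigmoid (-s) ^ β ≤
      Real.exp (-(Real.pi * min α β * Real.cos d * Real.sinh |ζ.re|)) := by
    refine (sigmoid_rpow_mul_sigmoid_neg_rpow_le_exp_abs hα hβ s).trans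
      (Real.exp_le_exp.2 (neg_le_neg ?_))
    calc Real.pi * min α β * Real.cos d * Real.sinh |ζ.re|
        = min α β * (Real.pi * Real.cos d * Real.sinh |ζ.re|) := by ring
      _ ≤ min α β * |s| :=
        mul_le_mul_of_nonneg_left (pi_mul_cos_mul_sinh_abs_re_le hd hζ) (le_min hα hβ)
  refine (norm_deIntegrand_le hK hα hα1 hβ (strip_mono hd.le hζ) hf hκ).trans ?_
  rw [deDecay, Real.cosh_abs]
  calc _ ≤ K * cTilde d ^ (1 - α) / Real.cos (Real.pi / 2 * Real.sin d) ^ (α + β) *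
        Real.exp (-(Real.pi * min α β * Real.cos d * Real.sinh |ζ.re|)) *
          (Real.pi * Real.cosh ζ.re) := by
        gcongr
        exact cos_pi_div_two_mul_sin_anti (le_of_lt hζ) hd.le
    _ = _ := by ring

end Integrand

section RealLine

theorem hasDerivAt_one_sub_mul_mul_exp_div {v u : ℝ} (hv : 1 + v + v ^ 2 ≠ 0) (hu : 1 + u ≠ 0) :
    HasDerivAt (fun u => (1 - v / (1 + v + v ^ 2) * u) * Real.exp u / (1 + u))
      ((v - u) * (v * u - 1) * (Real.exp u / ((1 + v + v ^ 2) * (1 + u) ^ 2))) u := by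
  have hlin := ((hasDerivAt_id' u).const_mul (v / (1 + v + v ^ 2))).const_sub 1
  refine ((hlin.mul (Real.hasDerivAt_exp u)).div ((hasDerivAt_id' u).const_add 1) hu).congr_deriv ?_
  simp only [Pi.mul_apply]
  field_simp
  ring

theorem le_max_of_hasDerivAt_of_sign {f f' : ℝ → ℝ} {p a b : ℝ} (hpa : p ≤ a) (hab : a ≤ b)
    (hf : ∀ x ∈ Set.Ici p, HasDerivAt f (f' x) x) (hpa' : ∀ x ∈ Set.Icc p a, f' x ≤ 0)
    (hab' : ∀ x ∈ Set.Icc a b, 0 ≤ f' x) (hb' : ∀ x ∈ Set.Ici b, f' x ≤ 0) {u : ℝ} (hu : p ≤ u) :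
    f u ≤ max (f p) (f b) := by
  have hcont : ∀ s ⊆ Set.Ici p, ContinuousOn f s := fun s hs x hx =>
    (hf x (hs hx)).continuousAt.continuousWithinAt
  have hder : ∀ s ⊆ Set.Ici p, ∀ x ∈ interior s, HasDerivWithinAt f (f' x) (interior s) x :=
    fun s hs x hx => (hf x (hs (interior_subset hx))).hasDerivWithinAt
  have hab_sub : Set.Icc a b ⊆ Set.Ici p := fun x hx => hpa.trans hx.1
  have hb_sub : Set.Ici b ⊆ Set.Ici p := Set.Ici_subset_Ici.2 (hpa.trans hab)
  rcases le_total u a with hua | hua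
  · have hanti : AntitoneOn f (Set.Icc p a) :=
      antitoneOn_of_hasDerivWithinAt_nonpos (convex_Icc _ _) (hcont _ Set.Icc_subset_Ici_self)
        (hder _ Set.Icc_subset_Ici_self) fun x hx => hpa' x (interior_subset hx)
    exact le_max_of_le_left (hanti ⟨le_rfl, hpa⟩ ⟨hu, hua⟩ hu)
  refine le_max_of_le_right ?_
  rcases le_total u b with hub | hub
  · have hmono : MonotoneOn f (Set.Icc a b) :=
      monotoneOn_of_hasDerivWithinAt_nonneg (convex_Icc _ _) (hcont _ hab_sub) (hder _ hab_sub)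
        fun x hx => hab' x (interior_subset hx)
    exact hmono ⟨hua, hub⟩ ⟨hab, le_rfl⟩ hub
  · have hanti : AntitoneOn f (Set.Ici b) :=
      antitoneOn_of_hasDerivWithinAt_nonpos (convex_Ici _) (hcont _ hb_sub) (hder _ hb_sub)
        fun x hx => hb' x (interior_subset hx)
    exact hanti Set.self_mem_Ici hub hub

theorem one_sub_mul_mul_exp_le {v : ℝ} (hv : 1 ≤ v) (hexp : Real.exp v ≤ 1 + v + v ^ 2) {u : ℝ}
    (hu : 0 ≤ u) : (1 - v / (1 + v + v ^ 2) * u) * Real.exp u ≤ 1 + u := by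
  have hv0 : 0 < v := by linarith
  have hvi : v⁻¹ ≤ v := (inv_le_one_of_one_le₀ hv).trans hv
  have hvi0 : 0 ≤ v⁻¹ := by positivity
  have hlow : ∀ x ≤ v⁻¹, v * x ≤ 1 := fun x hx =>
    mul_le_of_le_inv_mul₀ zero_le_one hv0.le (hx.trans_eq (mul_one _).symm)
  have hhigh : ∀ x, v⁻¹ ≤ x → 1 ≤ v * x := fun x hx => by rwa [← inv_le_iff_one_le_mul₀' hv0]
  have hfactor : ∀ x, 0 ≤ x → 0 ≤ Real.exp x / ((1 + v + v ^ 2) * (1 + x) ^ 2) := fun x _ => by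
    positivity
  have hmax := le_max_of_hasDerivAt_of_sign hvi0 hvi
    (fun x (hx : 0 ≤ x) => hasDerivAt_one_sub_mul_mul_exp_div (v := v) (by positivity)
      (by positivity))
    (fun x hx => mul_nonpos_of_nonpos_of_nonneg (mul_nonpos_of_nonneg_of_nonpos
      (by linarith [hx.2]) (by linarith [hlow x hx.2])) (hfactor x hx.1))
    (fun x hx => mul_nonneg (mul_nonneg (by linarith [hx.2]) (by linarith [hhigh x hx.1]))
      (hfactor x (hvi0.trans hx.1)))
    (fun x (hx : v ≤ x) => mul_nonpos_of_nonpos_of_nonneg (mul_nonpos_of_nonpos_of_nonneg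
      (by linarith) (by linarith [hhigh x (hvi.trans hx)])) (hfactor x (hv0.le.trans hx))) hu
  have hzero : (1 - v / (1 + v + v ^ 2) * 0) * Real.exp 0 / (1 + 0) = 1 := by simp
  have hpeak : (1 - v / (1 + v + v ^ 2) * v) * Real.exp v / (1 + v) =
      Real.exp v / (1 + v + v ^ 2) := by
    field_simp
    ring
  rw [hzero, hpeak, max_eq_left ((div_le_one (by positivity)).2 hexp),
    div_le_one (by positivity)] at hmax
  exact hmax

-- With `v = 1.79` both `exp v ≤ 1 + v + v ^ 2` (true up to `v ≈ 1.793`) and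
-- `v / (1 + v + v ^ 2) ≤ exp (π / 12) - 1` (true from `v ≈ 1.780` on) hold.
theorem one_add_mul_one_sub_exp_neg_le {u : ℝ} (hu : 0 ≤ u) :
    (1 + u) * (1 - Real.exp (-u)) ≤ Real.exp (Real.pi / 12) * u := by
  have hexp2 : Real.exp 2 ≤ 7.3891 := by
    have h1 := Real.exp_one_lt_d9
    have h0 := Real.exp_pos 1
    have h : Real.exp 2 = Real.exp 1 * Real.exp 1 := by rw [← Real.exp_add]; norm_num
    nlinarith
  have hexp : Real.exp 1.79 ≤ 1 + 1.79 + 1.79 ^ 2 := by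
    have h21 := Real.sum_le_exp_of_nonneg (x := 0.21) (by norm_num) 4
    simp only [Finset.sum_range_succ, Finset.sum_range_zero, Nat.factorial] at h21
    norm_num at h21
    have h : Real.exp 1.79 = Real.exp 2 / Real.exp 0.21 := by rw [← Real.exp_sub]; norm_num
    rw [h, div_le_iff₀ (Real.exp_pos _)]
    norm_num
    linarith
  have hπ : 1.79 / (1 + 1.79 + 1.79 ^ 2) ≤ Real.exp (Real.pi / 12) - 1 := by
    have h := Real.sum_le_exp_of_nonneg (x := 0.2617) (by norm_num) 4
    simp only [Finset.sum_range_succ, Finset.sum_range_zero, Nat.factorial] at h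
    have hmono : Real.exp 0.2617 ≤ Real.exp (Real.pi / 12) :=
      Real.exp_le_exp.2 (by linarith [Real.pi_gt_d4])
    norm_num at h ⊢
    linarith
  have hmain := one_sub_mul_mul_exp_le (by norm_num) hexp hu
  have hinv : Real.exp u * Real.exp (-u) = 1 := by
    rw [← Real.exp_add, add_neg_cancel, Real.exp_zero]
  have hle : 1 - 1.79 / (1 + 1.79 + 1.79 ^ 2) * u ≤ (1 + u) * Real.exp (-u) := by
    calc _ = (1 - 1.79 / (1 + 1.79 + 1.79 ^ 2) * u) * Real.exp u * Real.exp (-u) := by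
          rw [mul_assoc, hinv, mul_one]
      _ ≤ (1 + u) * Real.exp (-u) := by gcongr
  nlinarith [mul_le_mul_of_nonneg_right hπ hu]

variable {f : ℂ → ℂ} {K α β : ℝ}

theorem norm_deIntegrand_ofReal_le_sigmoid (hK : 0 ≤ K) (hα : 0 ≤ α) (hα1 : α ≤ 1) (hβ : 0 ≤ β)
    {x : ℝ} (hf : ‖f (psi x)‖ ≤ K * ‖E3 α β (psi x)‖) :
    ‖deIntegrand f x‖ ≤ K * Real.exp (Real.pi * (1 - α) / 12) *
      (Real.sigmoid (Real.pi * Real.sinh x) ^ α * Real.sigmoid (-(Real.pi * Real.sinh x)) ^ β) *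
        (Real.pi * Real.cosh x) := by
  have hκ : ‖1 + psi x‖ * ‖1 - Complex.exp (-psi x)‖ ≤ Real.exp (Real.pi / 12) * ‖psi x‖ := by
    have hu : 0 ≤ Real.log (1 + Real.exp (Real.pi * Real.sinh x)) :=
      Real.log_nonneg (by linarith [Real.exp_pos (Real.pi * Real.sinh x)])
    have h := one_add_mul_one_sub_exp_neg_le hu
    rw [psi_ofReal]
    generalize Real.log (1 + Real.exp (Real.pi * Real.sinh x)) = u at hu h
    have hexp : Real.exp (-u) ≤ 1 := Real.exp_le_one_iff.2 (by linarith)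
    norm_cast
    rwa [Real.norm_of_nonneg (by linarith), Real.norm_of_nonneg (by linarith),
      Real.norm_of_nonneg hu]
  have hrpow : Real.exp (Real.pi / 12) ^ (1 - α) = Real.exp (Real.pi * (1 - α) / 12) := by
    rw [← Real.exp_mul]
    ring_nf
  have h := norm_deIntegrand_le hK hα hα1 hβ
    (ofReal_mem_strip (by positivity) x) hf hκ
  rwa [(pi_mul_sinh_re_im _).1, Complex.ofReal_im, Complex.ofReal_re, Real.cos_zero, mul_one,
    Real.sin_zero, mul_zero, Real.cos_zero, Real.one_rpow, div_one, hrpow] at h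

theorem norm_deIntegrand_ofReal_le_deDecay (hK : 0 ≤ K) (hα : 0 ≤ α) (hα1 : α ≤ 1) (hβ : 0 ≤ β)
    {x : ℝ} (hf : ‖f (psi x)‖ ≤ K * ‖E3 α β (psi x)‖) :
    ‖deIntegrand f x‖ ≤
      K * Real.exp (Real.pi * (1 - α) / 12) * Real.pi * deDecay (Real.pi * β) x := by
  calc _ ≤ K * Real.exp (Real.pi * (1 - α) / 12) *
        Real.exp (-(β * (Real.pi * Real.sinh x))) * (Real.pi * Real.cosh x) :=
        (norm_deIntegrand_ofReal_le_sigmoid hK hα hα1 hβ hf).trans (by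
          gcongr
          exact sigmoid_rpow_mul_sigmoid_neg_rpow_le hα hβ _)
    _ = _ := by
        rw [deDecay]
        ring_nf

theorem norm_deIntegrand_ofReal_neg_le_deDecay (hK : 0 ≤ K) (hα : 0 ≤ α) (hα1 : α ≤ 1)
    (hβ : 0 ≤ β) {x : ℝ} (hf : ‖f (psi (-x : ℝ))‖ ≤ K * ‖E3 α β (psi (-x : ℝ))‖) :
    ‖deIntegrand f (-x : ℝ)‖ ≤
      K * Real.exp (Real.pi * (1 - α) / 12) * Real.pi * deDecay (Real.pi * α) x := by
  calc _ ≤ K * Real.exp (Real.pi * (1 - α) / 12) *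
        Real.exp (α * (Real.pi * Real.sinh (-x))) * (Real.pi * Real.cosh (-x)) :=
        (norm_deIntegrand_ofReal_le_sigmoid hK hα hα1 hβ hf).trans (by
          gcongr
          exact sigmoid_rpow_mul_sigmoid_neg_rpow_le_exp_mul hα hβ _)
    _ = _ := by
        rw [deDecay, Real.sinh_neg, Real.cosh_neg]
        ring_nf

end RealLine

section Decay

theorem deDecay_nonneg (a x : ℝ) : 0 ≤ deDecay a x := by
  have := Real.cosh_pos x
  unfold deDecay
  positivity

theorem continuous_deDecay (a : ℝ) : Continuous (deDecay a) := by
  have := Real.continuous_cosh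
  have := Real.continuous_sinh
  unfold deDecay
  fun_prop

theorem hasDerivAt_exp_neg_mul_sinh (a x : ℝ) :
    HasDerivAt (fun x => -Real.exp (-(a * Real.sinh x))) (a * deDecay a x) x := by
  refine (((Real.hasDerivAt_sinh x).const_mul a).fun_neg.exp).fun_neg.congr_deriv ?_
  rw [deDecay]
  ring

theorem hasDerivAt_deDecay (a x : ℝ) :
    HasDerivAt (deDecay a)
      ((Real.sinh x - a * (1 + Real.sinh x ^ 2)) * Real.exp (-(a * Real.sinh x))) x := by
  refine ((Real.hasDerivAt_cosh x).mul
    ((Real.hasDerivAt_sinh x).const_mul a).fun_neg.exp).congr_deriv ?_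
  linear_combination -a * Real.exp (-(a * Real.sinh x)) * Real.cosh_sq x

theorem tendsto_sinh_atTop : Tendsto Real.sinh atTop atTop :=
  tendsto_atTop_mono' _ ((eventually_ge_atTop 0).mono fun _ => Real.self_le_sinh_iff.2) tendsto_id

variable {b : ℝ}

theorem integral_deDecay_abs (hb : 0 < b) : ∫ x, deDecay b |x| = 2 / b := by
  have hlim : Tendsto (fun x => -Real.exp (-(b * Real.sinh x))) atTop (nhds (-0)) :=
    (Real.tendsto_exp_neg_atTop_nhds_zero.comp (tendsto_sinh_atTop.const_mul_atTop hb)).neg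
  have hint := integral_Ioi_of_hasDerivAt_of_nonneg' (a := 0)
    (fun x _ => hasDerivAt_exp_neg_mul_sinh b x)
    (fun x _ => mul_nonneg hb.le (deDecay_nonneg b x)) hlim
  rw [integral_const_mul, Real.sinh_zero, mul_zero, neg_zero, Real.exp_zero, zero_sub,
    neg_neg] at hint
  rw [integral_comp_abs (f := deDecay b)]
  field_simp
  linarith

theorem deDecay_abs_le (hb : 0 < b) (x : ℝ) :
    deDecay b |x| ≤ 6 * Real.exp b / b ^ 3 * (1 + x ^ 2)⁻¹ := by
  set S := Real.sinh |x|
  have hxS : |x| ≤ S := Real.self_le_sinh_iff.2 (abs_nonneg x)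
  have hS0 : 0 ≤ S := (abs_nonneg x).trans hxS
  have hcosh : Real.cosh |x| ≤ 1 + S :=
    abs_le_of_sq_le_sq' (by rw [Real.cosh_sq]; nlinarith) (by positivity) |>.2
  have hx2 : 1 + x ^ 2 ≤ (1 + S) ^ 2 := by rw [← sq_abs x]; nlinarith [abs_nonneg x]
  have hcube : (1 + S) ^ 3 ≤ 6 * Real.exp b / b ^ 3 * Real.exp (b * S) := by
    have h := Real.pow_div_factorial_le_exp (b * (1 + S)) (by positivity) 3
    rw [mul_add, mul_one, Real.exp_add] at h
    rw [div_mul_eq_mul_div, le_div_iff₀ (by positivity)]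
    norm_num [Nat.factorial] at h
    linarith
  rw [deDecay, Real.exp_neg, ← div_eq_mul_inv, ← div_eq_mul_inv,
    div_le_div_iff₀ (Real.exp_pos _) (by positivity)]
  calc Real.cosh |x| * (1 + x ^ 2) ≤ (1 + S) * (1 + S) ^ 2 := by gcongr
    _ = (1 + S) ^ 3 := by ring
    _ ≤ _ := hcube

theorem integrable_deDecay_abs (hb : 0 < b) : Integrable (fun x => deDecay b |x|) :=
  (integrable_inv_one_add_sq.const_mul _).mono'
    ((continuous_deDecay b).comp continuous_abs).aestronglyMeasurable
    (.of_forall fun x => by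
      rw [Real.norm_of_nonneg (deDecay_nonneg b _)]
      exact deDecay_abs_le hb x)

theorem isBigO_deDecay_abs (hb : 0 < b) :
    (fun x => deDecay b |x|) =O[cocompact ℝ] fun x => |x| ^ (-2 : ℝ) := by
  refine Asymptotics.IsBigO.of_bound (6 * Real.exp b / b ^ 3) ?_
  filter_upwards [(isCompact_singleton (x := (0 : ℝ))).compl_mem_cocompact] with x hx
  have hx2 : 0 < x ^ 2 := by have : x ≠ 0 := hx; positivity
  have hrpow : ‖|x| ^ (-2 : ℝ)‖ = (x ^ 2)⁻¹ := by
    rw [Real.norm_of_nonneg (by positivity), Real.rpow_neg (abs_nonneg x), Real.rpow_two, sq_abs]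
  rw [Real.norm_of_nonneg (deDecay_nonneg b _), hrpow]
  refine (deDecay_abs_le hb x).trans ?_
  gcongr
  linarith

end Decay

section TailSum

theorem sum_mul_le_integral_of_antitoneOn {F : ℝ → ℝ} {X h : ℝ} (hh : 0 < h) {m : ℕ}
    (hF : AntitoneOn F (Set.Icc X (X + h * m))) :
    ∑ j ∈ Finset.range m, h * F (X + h * (j + 1)) ≤ ∫ x in X..X + h * m, F x := by
  have hcomp : AntitoneOn (fun y => F (X + h * y)) (Set.Icc 0 (0 + (m : ℝ))) := by
    intro y hy z hz hyz
    rw [zero_add] at hy hz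
    refine hF ⟨?_, ?_⟩ ⟨?_, ?_⟩ ?_
    · linarith [mul_nonneg hh.le hy.1]
    · linarith [mul_le_mul_of_nonneg_left hy.2 hh.le]
    · linarith [mul_nonneg hh.le hz.1]
    · linarith [mul_le_mul_of_nonneg_left hz.2 hh.le]
    · linarith [mul_le_mul_of_nonneg_left hyz hh.le]
  have hsum := mul_le_mul_of_nonneg_left hcomp.sum_le_integral hh.le
  have hsubst := intervalIntegral.smul_integral_comp_add_mul (a := 0) (b := m) F h X
  rw [smul_eq_mul, mul_zero, add_zero] at hsubst
  simpa only [zero_add, hsubst, Finset.mul_sum, Nat.cast_add, Nat.cast_one] using hsum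

variable {a X p h : ℝ}

-- `deDecay a` may increase up to a peak `p`; freezing it at its peak value to the left of `p` gives
-- an antitone majorant, whose sums are bounded by its integral.
theorem integral_deDecay_max_le (ha : 0 ≤ a) (hXp : X ≤ p) {Y : ℝ} (hXY : X ≤ Y) :
    ∫ x in X..Y, a * deDecay a (max x p) ≤
      Real.exp (-(a * Real.sinh p)) * (1 + a * Real.cosh p * (p - X)) := by
  have hcont : Continuous fun x => a * deDecay a (max x p) :=
    ((continuous_deDecay a).comp (continuous_id.max continuous_const)).const_mul a
  have hflat : ∫ x in X..p, a * deDecay a (max x p) = (p - X) * (a * deDecay a p) := by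
    rw [← smul_eq_mul, ← intervalIntegral.integral_const]
    refine intervalIntegral.integral_congr fun x hx => ?_
    rw [Set.uIcc_of_le hXp] at hx
    simp only [max_eq_right hx.2]
  have htail : ∫ x in p..max Y p, a * deDecay a (max x p) =
      -Real.exp (-(a * Real.sinh (max Y p))) - -Real.exp (-(a * Real.sinh p)) := by
    rw [← intervalIntegral.integral_eq_sub_of_hasDerivAt
      (fun x _ => hasDerivAt_exp_neg_mul_sinh a x)
      (((continuous_deDecay a).const_mul a).intervalIntegrable _ _)]
    refine intervalIntegral.integral_congr fun x hx => ?_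
    rw [Set.uIcc_of_le (le_max_right _ _)] at hx
    simp only [max_eq_left hx.1]
  calc ∫ x in X..Y, a * deDecay a (max x p)
      ≤ ∫ x in X..max Y p, a * deDecay a (max x p) :=
        intervalIntegral.integral_mono_interval le_rfl hXY (le_max_left _ _)
          (.of_forall fun x => mul_nonneg ha (deDecay_nonneg a _)) (hcont.intervalIntegrable _ _)
    _ = (p - X) * (a * deDecay a p) +
          (Real.exp (-(a * Real.sinh p)) - Real.exp (-(a * Real.sinh (max Y p)))) := by
        rw [← intervalIntegral.integral_add_adjacent_intervals (hcont.intervalIntegrable X p)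
          (hcont.intervalIntegrable p _), hflat, htail]
        ring
    _ ≤ (p - X) * (a * deDecay a p) + Real.exp (-(a * Real.sinh p)) := by
        gcongr
        exact sub_le_self _ (Real.exp_pos _).le
    _ = _ := by
        rw [deDecay]
        ring

theorem sum_deDecay_le (ha : 0 ≤ a) (hh : 0 < h) (hXp : X ≤ p)
    (hmax : ∀ x ∈ Set.Icc X p, deDecay a x ≤ deDecay a p)
    (hanti : AntitoneOn (deDecay a) (Set.Ici p)) (m : ℕ) :
    ∑ j ∈ Finset.range m, h * (a * deDecay a (X + h * (j + 1))) ≤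
      Real.exp (-(a * Real.sinh p)) * (1 + a * Real.cosh p * (p - X)) := by
  have hle : ∀ x, X ≤ x → deDecay a x ≤ deDecay a (max x p) := fun x hx => by
    rcases le_total x p with hxp | hxp
    · simpa only [max_eq_right hxp] using hmax x ⟨hx, hxp⟩
    · rw [max_eq_left hxp]
  have hanti_max : Antitone fun x => a * deDecay a (max x p) := fun x y hxy =>
    mul_le_mul_of_nonneg_left
      (hanti (le_max_right x p) (le_max_right y p) (max_le_max_right p hxy)) ha
  refine le_trans ?_ ((sum_mul_le_integral_of_antitoneOn hh (hanti_max.antitoneOn _)).trans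
    (integral_deDecay_max_le ha hXp (le_add_of_nonneg_right (by positivity) : X ≤ X + h * m)))
  gcongr with j
  exact hle _ (le_add_of_nonneg_right (by positivity))

theorem antitoneOn_deDecay (h : ∀ s, Real.sinh p ≤ s → s ≤ a * (1 + s ^ 2)) :
    AntitoneOn (deDecay a) (Set.Ici p) :=
  antitoneOn_of_hasDerivWithinAt_nonpos (convex_Ici p) (continuous_deDecay a).continuousOn
    (fun x _ => (hasDerivAt_deDecay a x).hasDerivWithinAt) fun _ hx =>
    mul_nonpos_of_nonpos_of_nonneg
      (sub_nonpos.2 (h _ (Real.sinh_le_sinh.2 (interior_subset hx)))) (Real.exp_pos _).le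

theorem monotoneOn_deDecay
    (h : ∀ s, Real.sinh X ≤ s → s ≤ Real.sinh p → a * (1 + s ^ 2) ≤ s) :
    MonotoneOn (deDecay a) (Set.Icc X p) :=
  monotoneOn_of_hasDerivWithinAt_nonneg (convex_Icc X p) (continuous_deDecay a).continuousOn
    (fun x _ => (hasDerivAt_deDecay a x).hasDerivWithinAt) fun _ hx =>
    mul_nonneg (sub_nonneg.2 (h _ (Real.sinh_le_sinh.2 (interior_subset hx).1)
      (Real.sinh_le_sinh.2 (interior_subset hx).2))) (Real.exp_pos _).le

-- The critical points `x` of `deDecay a` solve `sinh x = a (cosh x) ^ 2`; for this `a` they are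
-- given by `sinh x = sinh p` and `sinh x = 1 / sinh p`.
theorem sub_sinh_div_cosh_sq_mul_one_add_sq (p s : ℝ) :
    s - Real.sinh p / Real.cosh p ^ 2 * (1 + s ^ 2) =
      (s - Real.sinh p) * (1 - s * Real.sinh p) / Real.cosh p ^ 2 := by
  field_simp
  rw [Real.cosh_sq]
  ring

theorem antitoneOn_deDecay_peak (hp : 1 ≤ Real.sinh p) :
    AntitoneOn (deDecay (Real.sinh p / Real.cosh p ^ 2)) (Set.Ici p) :=
  antitoneOn_deDecay fun s hs => by
    rw [← sub_nonpos, sub_sinh_div_cosh_sq_mul_one_add_sq]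
    exact div_nonpos_of_nonpos_of_nonneg
      (mul_nonpos_of_nonneg_of_nonpos (by linarith) (by nlinarith)) (by positivity)

theorem monotoneOn_deDecay_peak (hX : 0 ≤ Real.sinh X) (hXp : 1 ≤ Real.sinh X * Real.sinh p) :
    MonotoneOn (deDecay (Real.sinh p / Real.cosh p ^ 2)) (Set.Icc X p) :=
  monotoneOn_deDecay fun s hs hsp => by
    have hs1 : 1 ≤ s * Real.sinh p :=
      hXp.trans (mul_le_mul_of_nonneg_right hs (by linarith))
    rw [← sub_nonneg, sub_sinh_div_cosh_sq_mul_one_add_sq]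
    exact div_nonneg (mul_nonneg_of_nonpos_of_nonpos (by linarith) (by linarith)) (by positivity)

theorem sub_le_log_two_div_two (hX : Real.cosh p ≤ √2 * Real.sinh X) :
    p - X ≤ Real.log 2 / 2 := by
  have hsq2 : √2 ^ 2 = 2 := Real.sq_sqrt (by norm_num)
  have hsinh : Real.sinh p ≤ √2 * Real.cosh X := by
    refine abs_le_of_sq_le_sq' ?_ (by positivity) |>.2
    have hsq := pow_le_pow_left₀ (Real.cosh_pos p).le hX 2
    rw [mul_pow, hsq2, Real.cosh_sq] at hsq
    rw [mul_pow, hsq2, Real.cosh_sq]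
    linarith
  have hexp : Real.exp p ≤ √2 * Real.exp X := by
    rw [← Real.cosh_add_sinh, ← Real.cosh_add_sinh]
    linarith
  have hlog := Real.log_le_log (Real.exp_pos p) hexp
  rw [Real.log_exp, Real.log_mul (by positivity) (by positivity), Real.log_exp,
    Real.log_sqrt (by norm_num)] at hlog
  linarith

theorem log_four_le_of_cosh_le (hp : 3 ≤ Real.cosh p) (hX : Real.cosh p ≤ √2 * Real.sinh X) :
    Real.log 4 ≤ X := by
  have hsqrt : √2 ≤ 1.4143 := Real.sqrt_le_iff.2 (by norm_num)
  have hsinh : 0 < Real.sinh X := pos_of_mul_pos_right (by linarith) (Real.sqrt_nonneg 2)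
  refine Real.sinh_le_sinh.1 ?_
  rw [Real.sinh_log (by norm_num)]
  nlinarith

theorem exp_neg_log_two_div_two_le : Real.exp (-(Real.log 2 / 2)) ≤ 0.7072 := by
  refine abs_le_of_sq_le_sq' ?_ (by norm_num) |>.2
  rw [← Real.exp_nat_mul, Nat.cast_ofNat, mul_neg, mul_div_cancel₀ _ two_ne_zero, Real.exp_neg,
    Real.exp_log two_pos]
  norm_num

theorem exp_neg_le_exp_neg_add_sub {t τ : ℝ} (ht : 0 ≤ t) (hτ : t ≤ τ) :
    Real.exp (-t) ≤ Real.exp (-τ) + (τ - t) := by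
  have hsplit : Real.exp (-τ) = Real.exp (-t) * Real.exp (t - τ) := by
    rw [← Real.exp_add]
    ring_nf
  have hone : Real.exp (-t) ≤ 1 := Real.exp_le_one_iff.2 (by linarith)
  nlinarith [Real.add_one_le_exp (t - τ), Real.exp_pos (-t)]

-- The case of interest is `T = tanh p`, `q = 1 / cosh p`, `t = p - X`.
theorem add_mul_exp_neg_div_le {T q t L : ℝ} (hT : 0 ≤ T) (hTq : T ^ 2 + q ^ 2 = 1) (hq : 0 ≤ q)
    (hq1 : q ≤ 4 / 5) (ht : 0 ≤ t) (ht1 : t ≤ Real.log 2 / 2) (hL : 1 ≤ L)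
    (hL1 : q ≤ 1 / 3 → Real.log 4 ≤ L) : t + (1 + T) * Real.exp (-t) / (2 * L) ≤ T + q / 2 := by
  have hT1 : T ≤ 1 := by nlinarith
  have hTlow : 1 - q / 2 ≤ T := abs_le_of_sq_le_sq' (by nlinarith) hT |>.2
  set c := (1 + T) / (2 * L)
  have hc1 : c ≤ 1 := (div_le_one (by linarith)).2 (by linarith)
  have hexp : c * Real.exp (-t) ≤ c * 0.7072 + (Real.log 2 / 2 - t) := by
    have h := (exp_neg_le_exp_neg_add_sub ht ht1).trans
      (add_le_add_left exp_neg_log_two_div_two_le _)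
    have hc0 : 0 ≤ c := by positivity
    nlinarith
  have hlog := Real.log_two_lt_d9
  suffices c * 0.7072 + 0.3466 ≤ T + q / 2 by
    rw [mul_div_right_comm]
    linarith
  rcases le_total q (1 / 3) with hq3 | hq3
  · have hlog4 : Real.log 4 = 2 * Real.log 2 := by
      rw [← Real.log_rpow two_pos]
      norm_num
    have hc : c ≤ 0.722 := by
      rw [div_le_iff₀ (by positivity)]
      linarith [hL1 hq3, Real.log_two_gt_d9]
    linarith
  · have hc : c ≤ (1 + T) / 2 :=
      div_le_div_of_nonneg_left (by positivity) two_pos (by linarith)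
    linarith

theorem exp_neg_mul_one_add_mul_le {L : ℝ} (hp : 1 ≤ Real.sinh p)
    (ha : a = Real.sinh p / Real.cosh p ^ 2) (hX : Real.cosh p ≤ √2 * Real.sinh X)
    (hXp : X ≤ p) (hL : 1 ≤ L) (hXL : X ≤ L) :
    Real.exp (-(a * Real.sinh p)) * (1 + a * Real.cosh p * (p - X)) ≤
      Real.exp (a / 2 - a * Real.exp X / (2 * L)) := by
  set q := 1 / Real.cosh p with hq
  set T := Real.sinh p / Real.cosh p with hT
  have hC := Real.cosh_pos p
  have hT0 : 0 ≤ T := by positivity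
  have hTq : T ^ 2 + q ^ 2 = 1 := by
    rw [hT, hq]
    field_simp
    rw [Real.cosh_sq]
  have haT : a = T * q := by rw [ha, hT, hq]; field_simp
  have hasinh : a * Real.sinh p = T ^ 2 := by rw [ha, hT]; field_simp
  have hacosh : a * Real.cosh p = T := by rw [ha, hT]; field_simp
  have hexp : a * Real.exp X = T * (1 + T) * Real.exp (-(p - X)) := by
    have hX_eq : Real.exp X = (Real.cosh p + Real.sinh p) * Real.exp (-(p - X)) := by
      rw [Real.cosh_add_sinh, ← Real.exp_add]
      ring_nf
    rw [hX_eq]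
    linear_combination (hasinh + hacosh) * Real.exp (-(p - X))
  have hq1 : q ≤ 4 / 5 := by
    rw [hq, div_le_iff₀ hC]
    nlinarith [Real.cosh_sq p]
  have hL1 : q ≤ 1 / 3 → Real.log 4 ≤ L := fun hq3 => by
    refine (log_four_le_of_cosh_le ?_ hX).trans hXL
    rw [hq, div_le_div_iff₀ hC (by norm_num)] at hq3
    linarith
  have hmain := add_mul_exp_neg_div_le hT0 hTq (by positivity) hq1 (sub_nonneg.2 hXp)
    (sub_le_log_two_div_two hX) hL hL1
  rw [hasinh, hacosh]
  calc _ ≤ Real.exp (-T ^ 2) * Real.exp (T * (p - X)) := by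
        gcongr
        linarith [Real.add_one_le_exp (T * (p - X))]
    _ = Real.exp (T * (p - X - T)) := by
        rw [← Real.exp_add]
        ring_nf
    _ ≤ _ := by
        rw [Real.exp_le_exp, hexp, haT]
        have hmul := mul_le_mul_of_nonneg_left hmain hT0
        rw [mul_add, mul_div_assoc', ← mul_assoc] at hmul
        linarith

theorem xThreshold_nonneg {γ : ℝ} (hγ : 0 ≤ γ) : 0 ≤ xThreshold γ := by
  unfold xThreshold
  split_ifs
  · exact Real.arsinh_nonneg_iff.2 (by positivity)
  · exact Real.arsinh_nonneg_iff.2 zero_le_one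

-- The threshold is the point with `√2 * sinh (x_γ) = cosh p`, where `p` is the larger critical
-- point of `deDecay (π γ)`.
theorem exists_peak_of_xThreshold_le {γ : ℝ} (hγ : 0 < γ) (hγ1 : Real.pi * γ < 1 / 2)
    (hX : xThreshold γ ≤ X) :
    ∃ p, 1 ≤ Real.sinh p ∧ Real.pi * γ = Real.sinh p / Real.cosh p ^ 2 ∧
      Real.cosh p ≤ √2 * Real.sinh X := by
  have hlt : γ < 1 / (2 * Real.pi) := by
    rw [lt_div_iff₀ (by positivity)]
    linarith
  rw [xThreshold, if_pos hlt, show 2 * Real.pi * γ = 2 * (Real.pi * γ) by ring,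
    ← Real.sinh_le_sinh, Real.sinh_arsinh] at hX
  have ha : 0 < Real.pi * γ := by positivity
  generalize Real.pi * γ = a at ha hγ1 hX
  have hr : √(1 - (2 * a) ^ 2) ^ 2 = 1 - (2 * a) ^ 2 := Real.sq_sqrt (by nlinarith)
  set r := √(1 - (2 * a) ^ 2)
  have hr0 : 0 ≤ r := Real.sqrt_nonneg _
  have hcosh : Real.cosh (Real.arsinh ((1 + r) / (2 * a))) ^ 2 = (1 + r) / (2 * a ^ 2) := by
    rw [Real.cosh_sq, Real.sinh_arsinh]
    field_simp
    linear_combination hr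
  refine ⟨Real.arsinh ((1 + r) / (2 * a)), ?_, ?_, ?_⟩
  · rw [Real.sinh_arsinh, le_div_iff₀ (by positivity)]
    linarith
  · rw [hcosh, Real.sinh_arsinh]
    field_simp
  · refine le_trans ?_ (mul_le_mul_of_nonneg_left hX (Real.sqrt_nonneg 2))
    refine abs_le_of_sq_le_sq' (le_of_eq ?_) (by positivity) |>.2
    rw [hcosh, mul_pow, div_pow, Real.sq_sqrt (by norm_num), Real.sq_sqrt (by positivity)]
    field_simp

theorem sum_deDecay_le_exp_of_antitoneOn {L : ℝ} (ha : 0 ≤ a) (hh : 0 < h) (hX : 0 ≤ X)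
    (hL : 1 ≤ L) (hanti : AntitoneOn (deDecay a) (Set.Ici X)) (m : ℕ) :
    ∑ j ∈ Finset.range m, h * (a * deDecay a (X + h * (j + 1))) ≤
      Real.exp (a / 2 - a * Real.exp X / (2 * L)) := by
  refine (sum_deDecay_le ha hh le_rfl (fun x hx => by rw [le_antisymm hx.2 hx.1]) hanti m).trans ?_
  rw [sub_self, mul_zero, add_zero, mul_one, Real.exp_le_exp, Real.sinh_eq]
  have hexp : Real.exp (-X) ≤ 1 := Real.exp_le_one_iff.2 (by linarith)
  have hdiv : a * Real.exp X / (2 * L) ≤ a * Real.exp X / 2 := by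
    gcongr
    linarith
  nlinarith

theorem sum_deDecay_le_exp {γ L : ℝ} (hγ : 0 < γ) (hX : xThreshold γ ≤ X) (hh : 0 < h)
    (hL : 1 ≤ L) (hXL : X ≤ L) (m : ℕ) :
    ∑ j ∈ Finset.range m, h * (Real.pi * γ * deDecay (Real.pi * γ) (X + h * (j + 1))) ≤
      Real.exp (Real.pi * γ / 2 - Real.pi * γ * Real.exp X / (2 * L)) := by
  have hX0 := (xThreshold_nonneg hγ.le).trans hX
  have hπγ : 0 ≤ Real.pi * γ := by positivity
  rcases le_or_gt (1 / 2) (Real.pi * γ) with hγ1 | hγ1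
  · exact sum_deDecay_le_exp_of_antitoneOn hπγ hh hX0 hL
      (antitoneOn_deDecay fun s _ => by nlinarith [sq_nonneg (s - 1)]) m
  obtain ⟨p, hp, ha, hpX⟩ := exists_peak_of_xThreshold_le hγ hγ1 hX
  have hanti := antitoneOn_deDecay_peak hp
  rw [← ha] at hanti
  rcases le_total p X with hpX' | hXp
  · exact sum_deDecay_le_exp_of_antitoneOn hπγ hh hX0 hL
      (hanti.mono (Set.Ici_subset_Ici.2 hpX')) m
  have hsinh0 : 0 ≤ Real.sinh X := Real.sinh_nonneg_iff.2 hX0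
  have hprod : 1 ≤ Real.sinh X * Real.sinh p := by
    have hsq := pow_le_pow_left₀ (Real.cosh_pos p).le hpX 2
    rw [mul_pow, Real.sq_sqrt (by norm_num), Real.cosh_sq] at hsq
    have hX1 : 1 ≤ Real.sinh X := abs_le_of_sq_le_sq' (by nlinarith) hsinh0 |>.2
    exact one_le_mul_of_one_le_of_one_le hX1 hp
  have hmono := monotoneOn_deDecay_peak hsinh0 hprod
  rw [← ha] at hmono
  exact (sum_deDecay_le hπγ hh hXp (fun x hx => hmono hx ⟨hXp, le_rfl⟩ hx.2) hanti m).trans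
    (exp_neg_mul_one_add_mul_le hp ha hpX hXp hL hXL)

end TailSum

section ContourShift

variable {E : Type*} [NormedAddCommGroup E] {δ η : ℝ} {Q : ℂ → E} {P : ℝ → ℝ}

theorem add_mul_I_mem_strip (hη : |η| < δ) (x : ℝ) : (x + η * Complex.I : ℂ) ∈ strip δ := by
  simpa [strip] using hη

theorem integrable_horizontal (hη : |η| < δ) (hQ : ContinuousOn Q (strip δ)) (hP : Integrable P)
    (hQP : ∀ z ∈ strip δ, ‖Q z‖ ≤ P z.re) : Integrable fun x : ℝ => Q (x + η * Complex.I) :=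
  hP.mono' (hQ.comp_continuous (by fun_prop) (add_mul_I_mem_strip hη)).aestronglyMeasurable
    (.of_forall fun x => by simpa using hQP _ (add_mul_I_mem_strip hη x))

variable [NormedSpace ℂ E]

theorem tendsto_integral_vertical (hη : |η| < δ) (hP : Tendsto P (cocompact ℝ) (𝓝 0))
    (hQP : ∀ z ∈ strip δ, ‖Q z‖ ≤ P z.re) :
    Tendsto (fun x : ℝ => ∫ y in (0 : ℝ)..η, Q (x + y * Complex.I)) (cocompact ℝ) (𝓝 0) := by
  refine squeeze_zero_norm (fun x => intervalIntegral.norm_integral_le_of_norm_le_const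
    fun y hy => ?_) (by simpa using hP.mul_const |η - 0|)
  have hy' : |y| ≤ |η| := by simpa using Set.abs_sub_left_of_mem_uIcc (Set.uIoc_subset_uIcc hy)
  simpa using hQP _ (add_mul_I_mem_strip (hy'.trans_lt hη) x)

theorem integral_rect_eq (hη : |η| < δ) (hQ : DifferentiableOn ℂ Q (strip δ)) (R : ℝ) :
    (∫ x in -R..R, Q x) - ∫ x in -R..R, Q (x + η * Complex.I) =
      Complex.I • (∫ y in (0 : ℝ)..η, Q ((-R : ℝ) + y * Complex.I)) -
        Complex.I • ∫ y in (0 : ℝ)..η, Q (R + y * Complex.I) := by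
  have h := Complex.integral_boundary_rect_eq_zero_of_differentiableOn Q (-R : ℝ)
    (R + η * Complex.I) (hQ.mono fun z hz => ?_)
  · simp only [Complex.ofReal_im, Complex.ofReal_re, Complex.add_re, Complex.add_im,
      Complex.mul_re, Complex.mul_im, Complex.I_re, Complex.I_im, Complex.ofReal_zero, zero_mul,
      add_zero, mul_zero, mul_one, sub_zero, zero_add] at h
    rw [← sub_eq_zero, ← h]
    abel
  · have hz2 : z.im ∈ Set.uIcc (0 : ℝ) η := by simpa using hz.2
    exact lt_of_le_of_lt (by simpa using Set.abs_sub_left_of_mem_uIcc hz2) hη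

theorem integral_add_mul_I (hη : |η| < δ) (hQ : DifferentiableOn ℂ Q (strip δ))
    (hP : Integrable P) (hP0 : Tendsto P (cocompact ℝ) (𝓝 0))
    (hQP : ∀ z ∈ strip δ, ‖Q z‖ ≤ P z.re) :
    ∫ x : ℝ, Q (x + η * Complex.I) = ∫ x : ℝ, Q x := by
  have hδ : |(0 : ℝ)| < δ := by simpa using (abs_nonneg η).trans_lt hη
  have hint0 : Integrable fun x : ℝ => Q x := by
    simpa using integrable_horizontal hδ hQ.continuousOn hP hQP
  have hhor := (intervalIntegral_tendsto_integral hint0 tendsto_neg_atTop_atBot tendsto_id).sub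
    (intervalIntegral_tendsto_integral (integrable_horizontal hη hQ.continuousOn hP hQP)
      tendsto_neg_atTop_atBot tendsto_id)
  have hvert := tendsto_integral_vertical hη hP0 hQP
  have hver := ((hvert.comp (tendsto_neg_atTop_atBot.mono_right atBot_le_cocompact)).const_smul
    Complex.I).sub ((hvert.mono_left atTop_le_cocompact).const_smul Complex.I)
  have heq := tendsto_nhds_unique hhor (hver.congr fun R => (integral_rect_eq hη hQ R).symm)
  rw [smul_zero, sub_zero] at heq
  exact (sub_eq_zero.1 heq).symm

end ContourShift

section Trapezoid

open scoped FourierTransform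

variable {δ : ℝ} {φ : ℂ → ℂ} {P : ℝ → ℝ}

theorem norm_fourier_le_exp_mul_integral {η : ℝ} (hη : |η| < δ)
    (hφ : DifferentiableOn ℂ φ (strip δ)) (hP : Integrable P)
    (hP0 : Tendsto P (cocompact ℝ) (𝓝 0)) (hφP : ∀ z ∈ strip δ, ‖φ z‖ ≤ P z.re) (ξ : ℝ) :
    ‖𝓕 (fun x : ℝ => φ x) ξ‖ ≤ Real.exp (2 * Real.pi * (ξ * η)) * ∫ x, P x := by
  set Q : ℂ → ℂ := fun z => Complex.exp (-2 * Real.pi * z * ξ * Complex.I) * φ z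
  have hQnorm : ∀ z, ‖Q z‖ = Real.exp (2 * Real.pi * (ξ * z.im)) * ‖φ z‖ := fun z => by
    rw [norm_mul, Complex.norm_exp]
    congr 2
    simp
    ring
  have hQ : DifferentiableOn ℂ Q (strip δ) := DifferentiableOn.mul (by fun_prop) hφ
  have hQP : ∀ z ∈ strip δ, ‖Q z‖ ≤ Real.exp (2 * Real.pi * (|ξ| * δ)) * P z.re := fun z hz => by
    rw [hQnorm]
    gcongr ?_ * ?_
    · have hz' : ξ * z.im ≤ |ξ| * δ := (le_abs_self _).trans ((abs_mul _ _).trans_le (by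
        gcongr
        exact le_of_lt hz))
      gcongr
    · exact hφP z hz
  have hshift := integral_add_mul_I hη hQ (hP.const_mul _)
    (by simpa using hP0.const_mul (Real.exp (2 * Real.pi * (|ξ| * δ)))) hQP
  have hfourier : 𝓕 (fun x : ℝ => φ x) ξ = ∫ x : ℝ, Q x := by
    rw [Real.fourier_real_eq_integral_exp_smul]
    congr 1 with x
    simp [Q]
  rw [hfourier, ← hshift, ← integral_const_mul]
  refine norm_integral_le_of_norm_le (hP.const_mul _) (.of_forall fun x => ?_)
  have hφx := hφP _ (add_mul_I_mem_strip hη x)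
  simp only [Complex.add_re, Complex.ofReal_re, Complex.re_ofReal_mul, Complex.I_re, mul_zero,
    add_zero] at hφx
  rw [hQnorm]
  gcongr ?_ * ?_
  simp

theorem norm_fourier_le (hδ : 0 < δ) (hφ : DifferentiableOn ℂ φ (strip δ)) (hP : Integrable P)
    (hP0 : Tendsto P (cocompact ℝ) (𝓝 0)) (hφP : ∀ z ∈ strip δ, ‖φ z‖ ≤ P z.re) (ξ : ℝ) :
    ‖𝓕 (fun x : ℝ => φ x) ξ‖ ≤ Real.exp (-(2 * Real.pi * δ)) ^ |ξ| * ∫ x, P x := by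
  have hlim : Tendsto (fun δ' => Real.exp (-(2 * Real.pi * δ')) ^ |ξ| * ∫ x, P x) (𝓝[<] δ)
      (𝓝 (Real.exp (-(2 * Real.pi * δ)) ^ |ξ| * ∫ x, P x)) := by
    simp only [← Real.exp_mul]
    exact (Continuous.tendsto (by fun_prop) δ).mono_left nhdsWithin_le_nhds
  refine ge_of_tendsto hlim ?_
  filter_upwards [Ioo_mem_nhdsLT hδ] with δ' hδ'
  have habs : |δ'| < δ := (abs_of_pos hδ'.1).trans_lt hδ'.2
  rw [← Real.exp_mul]
  rcases le_total 0 ξ with hξ | hξ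
  · exact (norm_fourier_le_exp_mul_integral ((abs_neg δ').trans_lt habs) hφ hP hP0 hφP ξ).trans_eq
      (by rw [abs_of_nonneg hξ]; ring_nf)
  · exact (norm_fourier_le_exp_mul_integral habs hφ hP hP0 hφP ξ).trans_eq
      (by rw [abs_of_nonpos hξ]; ring_nf)

theorem summable_and_norm_apply_zero_sub_tsum_le {E : Type*} [NormedAddCommGroup E]
    [CompleteSpace E] {a : ℤ → E} {J r : ℝ} (hr : 0 ≤ r) (hr1 : r < 1)
    (ha : ∀ n, ‖a n‖ ≤ J * r ^ n.natAbs) :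
    Summable a ∧ ‖a 0 - ∑' n, a n‖ ≤ 2 * J * (r / (1 - r)) := by
  have hgeo : HasSum (fun n : ℕ => J * r ^ (n + 1)) (J * (r / (1 - r))) := by
    simpa only [pow_succ', div_eq_mul_inv] using
      ((hasSum_geometric_of_lt_one hr hr1).mul_left r).mul_left J
  have hpos : ∀ n : ℕ, ‖a ((n + 1 : ℕ) : ℤ)‖ ≤ J * r ^ (n + 1) := fun n => ha _
  have hneg : ∀ n : ℕ, ‖a (-((n : ℤ) + 1))‖ ≤ J * r ^ (n + 1) := fun n => by
    have h := ha (-((n + 1 : ℕ) : ℤ))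
    rwa [Int.natAbs_neg, Int.natAbs_natCast, Nat.cast_succ] at h
  have hsum_pos : Summable fun n : ℕ => a n :=
    (summable_nat_add_iff 1).1 (hgeo.summable.of_norm_bounded hpos)
  have hsum_neg : Summable fun n : ℕ => a (-((n : ℤ) + 1)) := hgeo.summable.of_norm_bounded hneg
  refine ⟨.of_nat_of_neg_add_one hsum_pos hsum_neg, ?_⟩
  rw [tsum_of_nat_of_neg_add_one hsum_pos hsum_neg, hsum_pos.tsum_eq_zero_add, Nat.cast_zero,
    add_assoc, sub_add_cancel_left, norm_neg, two_mul, add_mul]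
  exact (norm_add_le _ _).trans
    (add_le_add (tsum_of_norm_bounded hgeo hpos) (tsum_of_norm_bounded hgeo hneg))

theorem tendsto_zero_of_isBigO_rpow_neg {s : ℝ} (hs : 0 < s)
    (hO : P =O[cocompact ℝ] fun x => |x| ^ (-s)) : Tendsto P (cocompact ℝ) (𝓝 0) :=
  hO.trans_tendsto ((tendsto_rpow_neg_atTop hs).comp (tendsto_norm_cocompact_atTop (E := ℝ)))

theorem norm_integral_sub_tsum_int_le {s : ℝ} (hδ : 0 < δ) (hs : 1 < s)
    (hφ : DifferentiableOn ℂ φ (strip δ)) (hP : Integrable P)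
    (hO : P =O[cocompact ℝ] fun x => |x| ^ (-s)) (hφP : ∀ z ∈ strip δ, ‖φ z‖ ≤ P z.re) :
    ‖(∫ x : ℝ, φ x) - ∑' k : ℤ, φ (k : ℝ)‖ ≤
      2 * (∫ x, P x) * (Real.exp (-(2 * Real.pi * δ)) / (1 - Real.exp (-(2 * Real.pi * δ)))) := by
  have hcont : Continuous fun x : ℝ => φ x :=
    hφ.continuousOn.comp_continuous Complex.continuous_ofReal (ofReal_mem_strip hδ)
  have hP0 := tendsto_zero_of_isBigO_rpow_neg (by linarith) hO
  have hφO : (fun x : ℝ => φ x) =O[cocompact ℝ] fun x => |x| ^ (-s) :=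
    (Asymptotics.isBigO_of_le _ fun x : ℝ => (hφP x (ofReal_mem_strip hδ x)).trans (by
      simpa using le_abs_self (P x))).trans hO
  have hr1 : Real.exp (-(2 * Real.pi * δ)) < 1 := Real.exp_lt_one_iff.2
    (neg_lt_zero.2 (by positivity))
  obtain ⟨hsum, hle⟩ := summable_and_norm_apply_zero_sub_tsum_le
    (a := fun n : ℤ => 𝓕 (fun x : ℝ => φ x) n) (Real.exp_pos _).le hr1 fun n => by
      have h := norm_fourier_le hδ hφ hP hP0 hφP n
      rwa [← Int.cast_abs, Int.abs_eq_natAbs, Int.cast_natCast, Real.rpow_natCast, mul_comm] at h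
  have hpoisson : ∑' k : ℤ, φ (k : ℝ) = ∑' n : ℤ, 𝓕 (fun x : ℝ => φ x) n := by
    simpa using Real.tsum_eq_tsum_fourier_of_rpow_decay_of_summable hcont hs hφO hsum 0
  have hzero : 𝓕 (fun x : ℝ => φ x) (0 : ℤ) = ∫ x : ℝ, φ x := by
    simp [Real.fourier_real_eq_integral_exp_smul]
  rwa [hpoisson, ← hzero]

theorem norm_integral_sub_mul_tsum_le {d h s : ℝ} (hd : 0 < d) (hh : 0 < h) (hs : 1 < s)
    (hφ : DifferentiableOn ℂ φ (strip d)) (hP : Integrable P)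
    (hO : P =O[cocompact ℝ] fun x => |x| ^ (-s)) (hφP : ∀ z ∈ strip d, ‖φ z‖ ≤ P z.re) :
    ‖(∫ x : ℝ, φ x) - h * ∑' k : ℤ, φ ((k * h : ℝ) : ℂ)‖ ≤
      2 * (∫ x, P x) *
        (Real.exp (-(2 * Real.pi * d / h)) / (1 - Real.exp (-(2 * Real.pi * d / h)))) := by
  have hmaps : ∀ z ∈ strip (d / h), z * h ∈ strip d := fun z (hz : |z.im| < d / h) => by
    rw [lt_div_iff₀ hh] at hz
    simpa [strip, abs_mul, abs_of_pos hh] using hz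
  have hOh : (fun x => P (x * h)) =O[cocompact ℝ] fun x => |x| ^ (-s) := by
    refine (hO.comp_tendsto (Filter.tendsto_cocompact_mul_right (mul_inv_cancel₀ hh.ne'))).trans ?_
    simp only [Function.comp_def, abs_mul, Real.mul_rpow (abs_nonneg _) (abs_nonneg h)]
    simpa only [mul_comm] using
      Asymptotics.isBigO_const_mul_self (|h| ^ (-s)) (fun x => |x| ^ (-s)) (cocompact ℝ)
  have hunit := norm_integral_sub_tsum_int_le (φ := fun z => φ (z * h)) (div_pos hd hh) hs
    (hφ.comp (by fun_prop) hmaps) (hP.comp_mul_right' hh.ne') hOh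
    (fun z hz => (hφP _ (hmaps z hz)).trans_eq (by simp))
  have hint : ∫ x : ℝ, φ (x * h) = (h⁻¹ : ℂ) * ∫ x : ℝ, φ x := by
    simpa [abs_of_pos hh] using Measure.integral_comp_mul_right (fun x : ℝ => φ x) h
  rw [hint, Measure.integral_comp_mul_right P h, abs_of_pos (inv_pos.2 hh), smul_eq_mul,
    ← mul_div_assoc (2 * Real.pi)] at hunit
  have hh' : (h : ℂ) ≠ 0 := Complex.ofReal_ne_zero.2 hh.ne'
  simp only [Complex.ofReal_mul]
  rw [← mul_inv_cancel_left₀ hh' (∫ x : ℝ, φ x), ← mul_sub, norm_mul, Complex.norm_real,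
    Real.norm_of_nonneg hh.le]
  refine (mul_le_mul_of_nonneg_left hunit hh.le).trans_eq ?_
  field_simp

end Trapezoid

section BilateralSum

variable {E : Type*} [NormedAddCommGroup E] [CompleteSpace E]

theorem summable_and_norm_tsum_le_of_sum_norm_le {v : ℕ → E} {A : ℝ}
    (hA : ∀ m, ∑ j ∈ Finset.range m, ‖v j‖ ≤ A) : Summable v ∧ ‖∑' j, v j‖ ≤ A := by
  have hsum : Summable fun j => ‖v j‖ := summable_of_sum_range_le (fun _ => norm_nonneg _) hA
  exact ⟨hsum.of_norm, (norm_tsum_le_tsum_norm hsum).trans (hsum.tsum_le_of_sum_range_le hA)⟩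

theorem norm_tsum_int_sub_sum_Icc_le {u : ℤ → E} {M N : ℤ} (hMN : -M ≤ N) {A B : ℝ}
    (hA : ∀ m, ∑ j ∈ Finset.range m, ‖u (-(M + (j + 1)))‖ ≤ A)
    (hB : ∀ m, ∑ j ∈ Finset.range m, ‖u (N + (j + 1))‖ ≤ B) :
    ‖∑' k, u k - ∑ k ∈ Finset.Icc (-M) N, u k‖ ≤ A + B := by
  obtain ⟨hsumA, hleA⟩ := summable_and_norm_tsum_le_of_sum_norm_le hA
  obtain ⟨hsumB, hleB⟩ := summable_and_norm_tsum_le_of_sum_norm_le hB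
  set l : ℕ := (M + N + 1).toNat
  have hl : (l : ℤ) = M + N + 1 := Int.toNat_of_nonneg (by omega)
  have hshift : ∀ j : ℕ, u (N - (j + l : ℕ)) = u (-(M + (j + 1))) := fun j => by
    congr 1
    omega
  have hsum_down : Summable fun j : ℕ => u (N - j) :=
    (summable_nat_add_iff l).1 (by simpa only [hshift] using hsumA)
  have hIcc : ∑ j ∈ Finset.range l, u (N - j) = ∑ k ∈ Finset.Icc (-M) N, u k :=
    Finset.sum_nbij' (fun j => N - j) (fun k => (N - k).toNat)
      (fun j hj => by simp only [Finset.mem_range, Finset.mem_Icc] at hj ⊢; omega)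
      (fun k hk => by simp only [Finset.mem_range, Finset.mem_Icc] at hk ⊢; omega)
      (fun j _ => by omega)
      (fun k hk => by simp only [Finset.mem_Icc] at hk; omega) fun _ _ => rfl
  have hdown : ∑' j : ℕ, u (N - j) =
      ∑ k ∈ Finset.Icc (-M) N, u k + ∑' j : ℕ, u (-(M + (j + 1))) := by
    simp only [← hsum_down.sum_add_tsum_nat_add l, hIcc, hshift]
  have hsplit : ∑' k, u k = ∑' j : ℕ, u (N + (j + 1)) + ∑' j : ℕ, u (N - j) := by
    have hup : ∀ j : ℕ, u (N + 1 + j) = u (N + (j + 1)) := fun j => by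
      congr 1
      ring
    have hflip : ∀ j : ℕ, u (N + 1 + -(j + 1)) = u (N - j) := fun j => by
      congr 1
      ring
    rw [← (Equiv.addLeft (N + 1)).tsum_eq]
    simpa only [Equiv.coe_addLeft, hup, hflip] using
      tsum_of_nat_of_neg_add_one (f := fun k => u (N + 1 + k)) (by simpa only [hup] using hsumB)
        (by simpa only [hflip] using hsum_down)
  rw [hsplit, hdown, add_left_comm, add_sub_cancel_left, add_comm]
  exact (norm_add_le _ _).trans (add_le_add hleA hleB)

end BilateralSum

section ChangeOfVariables

variable {f : ℂ → ℂ}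

theorem hasDerivAt_log_one_add_exp_pi_mul_sinh (t : ℝ) :
    HasDerivAt (fun t => Real.log (1 + Real.exp (Real.pi * Real.sinh t)))
      (Real.pi * Real.cosh t / (1 + Real.exp (-(Real.pi * Real.sinh t)))) t := by
  refine (((((Real.hasDerivAt_sinh t).const_mul Real.pi).exp).const_add 1).log
    (by positivity)).congr_deriv ?_
  rw [Real.exp_neg]
  field_simp
  ring

theorem range_log_one_add_exp_pi_mul_sinh :
    Set.range (fun t => Real.log (1 + Real.exp (Real.pi * Real.sinh t))) = Set.Ioi 0 := by
  ext y
  constructor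
  · rintro ⟨t, rfl⟩
    exact Real.log_pos (lt_add_of_pos_right 1 (Real.exp_pos _))
  · intro hy
    have hexp : 0 < Real.exp y - 1 := sub_pos.2 (Real.one_lt_exp_iff.2 hy)
    refine ⟨Real.arsinh (Real.log (Real.exp y - 1) / Real.pi), ?_⟩
    simp only [Real.sinh_arsinh, mul_div_cancel₀ _ Real.pi_ne_zero, Real.exp_log hexp,
      add_sub_cancel, Real.log_exp]

theorem injective_log_one_add_exp_pi_mul_sinh :
    Function.Injective fun t => Real.log (1 + Real.exp (Real.pi * Real.sinh t)) := fun s t h =>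
  Real.sinh_injective <| mul_left_cancel₀ Real.pi_ne_zero <| Real.exp_injective <|
    add_left_cancel <| Real.log_injOn_pos (Set.mem_Ioi.2 (by positivity))
      (Set.mem_Ioi.2 (by positivity)) h

theorem deriv_psi_ofReal (t : ℝ) : deriv psi t =
    (Real.pi * Real.cosh t / (1 + Real.exp (-(Real.pi * Real.sinh t))) : ℝ) := by
  have ht := ofReal_mem_strip Real.pi_div_two_pos t
  rw [deriv_psi ht, one_sub_exp_neg_psi ht, Complex.sinh_neg, mul_neg]
  push_cast
  rw [div_eq_mul_inv]

theorem abs_deriv_smul_comp_eq_deIntegrand (f : ℂ → ℂ) (t : ℝ) :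
    |Real.pi * Real.cosh t / (1 + Real.exp (-(Real.pi * Real.sinh t)))| •
      f (Real.log (1 + Real.exp (Real.pi * Real.sinh t)) : ℝ) = deIntegrand f t := by
  rw [abs_of_nonneg (by positivity), ← psi_ofReal, deIntegrand, deriv_psi_ofReal,
    Complex.real_smul, mul_comm]

theorem integrableOn_Ioi_iff_integrable_deIntegrand :
    IntegrableOn (fun t : ℝ => f t) (Set.Ioi 0) ↔ Integrable fun t : ℝ => deIntegrand f t := by
  have h := integrableOn_image_iff_integrableOn_abs_deriv_smul MeasurableSet.univ
    (fun t _ => (hasDerivAt_log_one_add_exp_pi_mul_sinh t).hasDerivWithinAt)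
    injective_log_one_add_exp_pi_mul_sinh.injOn fun t : ℝ => f t
  simpa only [abs_deriv_smul_comp_eq_deIntegrand, Set.image_univ,
    range_log_one_add_exp_pi_mul_sinh, integrableOn_univ] using h

theorem integral_Ioi_eq_integral_deIntegrand (f : ℂ → ℂ) :
    ∫ t in Set.Ioi (0 : ℝ), f t = ∫ t : ℝ, deIntegrand f t := by
  have h := integral_image_eq_integral_abs_deriv_smul MeasurableSet.univ
    (fun t _ => (hasDerivAt_log_one_add_exp_pi_mul_sinh t).hasDerivWithinAt)
    injective_log_one_add_exp_pi_mul_sinh.injOn fun t : ℝ => f t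
  simpa only [abs_deriv_smul_comp_eq_deIntegrand, Set.image_univ,
    range_log_one_add_exp_pi_mul_sinh, setIntegral_univ] using h

end ChangeOfVariables

section Quadrature

variable {f : ℂ → ℂ} {K α β d h L : ℝ}

theorem differentiableOn_deIntegrand (hd : d ≤ Real.pi / 2)
    (hf : DifferentiableOn ℂ f (psi '' strip d)) : DifferentiableOn ℂ (deIntegrand f) (strip d) :=
  have hpsi := differentiableOn_psi.mono (strip_mono hd)
  (hf.comp hpsi (Set.mapsTo_image _ _)).mul (hpsi.deriv (isOpen_strip d))

theorem integrable_deIntegrand (hd0 : 0 < d) (hd : d < Real.pi / 2) (hK : 0 ≤ K) (hα : 0 < α)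
    (hα1 : α ≤ 1) (hβ : 0 < β) (hf : ContinuousOn (deIntegrand f) (strip d))
    (hbound : ∀ z ∈ psi '' strip d, ‖f z‖ ≤ K * ‖E3 α β z‖) :
    Integrable fun t : ℝ => deIntegrand f t := by
  have hcos : 0 < Real.cos d := Real.cos_pos_of_mem_Ioo ⟨by linarith, hd⟩
  have hb : 0 < Real.pi * min α β * Real.cos d := by positivity
  refine ((integrable_deDecay_abs hb).const_mul _).mono'
    (hf.comp_continuous Complex.continuous_ofReal (ofReal_mem_strip hd0)).aestronglyMeasurable
    (.of_forall fun t => norm_deIntegrand_le_deDecay hd hK hα.le hα1 hβ.le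
      (ofReal_mem_strip hd0 t) (hbound _ ⟨_, ofReal_mem_strip hd0 t, rfl⟩))

theorem norm_integral_deIntegrand_sub_tsum_le (hd0 : 0 < d) (hd : d < Real.pi / 2) (hK : 0 ≤ K)
    (hα : 0 < α) (hα1 : α ≤ 1) (hβ : 0 < β) (hf : DifferentiableOn ℂ f (psi '' strip d))
    (hbound : ∀ z ∈ psi '' strip d, ‖f z‖ ≤ K * ‖E3 α β z‖) (hh : 0 < h) :
    ‖(∫ t : ℝ, deIntegrand f t) - h * ∑' k : ℤ, deIntegrand f ((k * h : ℝ) : ℂ)‖ ≤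
      4 * K * cTilde d ^ (1 - α) /
          (min α β * Real.cos (Real.pi / 2 * Real.sin d) ^ (α + β) * Real.cos d) *
        (Real.exp (-(2 * Real.pi * d / h)) / (1 - Real.exp (-(2 * Real.pi * d / h)))) := by
  have hcos : 0 < Real.cos d := Real.cos_pos_of_mem_Ioo ⟨by linarith, hd⟩
  have hb : 0 < Real.pi * min α β * Real.cos d := by positivity
  refine (norm_integral_sub_mul_tsum_le hd0 hh one_lt_two (differentiableOn_deIntegrand hd.le hf)
    ((integrable_deDecay_abs hb).const_mul _) ((isBigO_deDecay_abs hb).const_mul_left _)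
    fun z hz => norm_deIntegrand_le_deDecay hd hK hα.le hα1 hβ.le hz
      (hbound _ ⟨z, hz, rfl⟩)).trans_eq ?_
  rw [integral_const_mul, integral_deDecay_abs hb]
  field_simp
  ring

theorem sum_norm_mul_le_of_norm_le_deDecay {g : ℝ → ℂ} {C γ X : ℝ} (hγ : 0 < γ) (hC : 0 ≤ C)
    (hg : ∀ x, ‖g x‖ ≤ C * Real.pi * deDecay (Real.pi * γ) x) (hX : xThreshold γ ≤ X)
    (hh : 0 < h) (hL : 1 ≤ L) (hXL : X ≤ L) (m : ℕ) :
    ∑ j ∈ Finset.range m, ‖h * g (X + h * (j + 1))‖ ≤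
      C * (Real.exp (Real.pi * γ / 2 - Real.pi * γ * Real.exp X / (2 * L)) / γ) :=
  calc ∑ j ∈ Finset.range m, ‖h * g (X + h * (j + 1))‖
      ≤ ∑ j ∈ Finset.range m,
          h * (C * Real.pi * deDecay (Real.pi * γ) (X + h * (j + 1))) := by
        gcongr with j
        rw [norm_mul, Complex.norm_real, Real.norm_of_nonneg hh.le]
        gcongr
        exact hg _
    _ = C * ((∑ j ∈ Finset.range m,
          h * (Real.pi * γ * deDecay (Real.pi * γ) (X + h * (j + 1)))) / γ) := by
        rw [Finset.sum_div, Finset.mul_sum]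
        refine Finset.sum_congr rfl fun j _ => ?_
        field_simp
    _ ≤ _ := by
        gcongr
        exact sum_deDecay_le_exp hγ hX hh hL hXL m

theorem norm_tsum_deIntegrand_sub_sum_le (hK : 0 ≤ K) (hα : 0 < α) (hα1 : α ≤ 1) (hβ : 0 < β)
    (hbound : ∀ x : ℝ, ‖f (psi x)‖ ≤ K * ‖E3 α β (psi x)‖) (hh : 0 < h) (hL : 1 ≤ L) {M N : ℤ}
    (hMX : xThreshold α ≤ M * h) (hML : M * h ≤ L) (hNX : xThreshold β ≤ N * h)
    (hNL : N * h ≤ L) :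
    ‖h * ∑' k : ℤ, deIntegrand f ((k * h : ℝ) : ℂ) -
        h * ∑ k ∈ Finset.Icc (-M) N, deIntegrand f ((k * h : ℝ) : ℂ)‖ ≤
      K * Real.exp (Real.pi * (1 - α) / 12) *
          (Real.exp (Real.pi * α / 2 - Real.pi * α * Real.exp (M * h) / (2 * L)) / α) +
        K * Real.exp (Real.pi * (1 - α) / 12) *
          (Real.exp (Real.pi * β / 2 - Real.pi * β * Real.exp (N * h) / (2 * L)) / β) := by
  have hM : (0 : ℝ) ≤ M := nonneg_of_mul_nonneg_left ((xThreshold_nonneg hα.le).trans hMX) hh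
  have hN : (0 : ℝ) ≤ N := nonneg_of_mul_nonneg_left ((xThreshold_nonneg hβ.le).trans hNX) hh
  have hMN : -M ≤ N := (neg_nonpos.2 (Int.cast_nonneg_iff.1 hM)).trans (Int.cast_nonneg_iff.1 hN)
  rw [← tsum_mul_left, Finset.mul_sum]
  refine norm_tsum_int_sub_sum_Icc_le hMN (fun m => ?_) fun m => ?_
  · have hindex (j : ℕ) : ((-(M + (j + 1)) : ℤ) : ℝ) * h = -(M * h + h * (j + 1)) := by
      push_cast
      ring
    simpa only [hindex] using sum_norm_mul_le_of_norm_le_deDecay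
      (g := fun x => deIntegrand f (-x : ℝ)) hα (by positivity)
      (fun x => norm_deIntegrand_ofReal_neg_le_deDecay hK hα.le hα1 hβ.le (hbound _))
      hMX hh hL hML m
  · have hindex (j : ℕ) : ((N + (j + 1) : ℤ) : ℝ) * h = N * h + h * (j + 1) := by
      push_cast
      ring
    simpa only [hindex] using sum_norm_mul_le_of_norm_le_deDecay
      (g := fun x => deIntegrand f x) hβ (by positivity)
      (fun x => norm_deIntegrand_ofReal_le_deDecay hK hα.le hα1 hβ.le (hbound _))
      hNX hh hL hNL m

end Quadrature

section Truncation

variable {α β h : ℝ} {n : ℕ}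

theorem upperNum_eq_lowerNum (α β h : ℝ) (n : ℕ) : upperNum α β h n = lowerNum β α h n := by
  rw [upperNum, lowerNum, min_comm]

theorem lowerNum_mul_le (hβ : 0 < β) (hh : 0 ≤ h) : lowerNum α β h n * h ≤ n * h := by
  rw [lowerNum]
  split_ifs with hmin
  · simp
  · have hlt : β < α := not_le.1 (mt min_eq_left hmin)
    have hlog : 0 ≤ Real.log (α / β) := Real.log_nonneg ((one_le_div hβ).2 hlt.le)
    have hfloor : (0 : ℝ) ≤ ⌊Real.log (α / β) / h⌋ := by
      exact_mod_cast Int.floor_nonneg.2 (div_nonneg hlog hh)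
    push_cast
    gcongr
    exact sub_le_self _ hfloor

theorem min_mul_exp_le_mul_exp_lowerNum (hα : 0 < α) (hβ : 0 < β) (hh : 0 < h) :
    min α β * Real.exp (n * h) ≤ α * Real.exp (lowerNum α β h n * h) := by
  rw [lowerNum]
  split_ifs with hmin
  · simp [hmin]
  · have hlt : β < α := not_le.1 (mt min_eq_left hmin)
    have hfloor := (le_div_iff₀ hh).1 (Int.floor_le (Real.log (α / β) / h))
    calc min α β * Real.exp (n * h) = α * Real.exp (n * h - Real.log (α / β)) := by
          rw [min_eq_right hlt.le, Real.exp_sub, Real.exp_log (by positivity)]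
          field_simp
      _ ≤ _ := by
          push_cast
          gcongr
          linarith

theorem exp_sub_mul_exp_lowerNum_le {L : ℝ} (hα : 0 < α) (hβ : 0 < β) (hh : 0 < h) (hL : 0 ≤ L) :
    Real.exp (Real.pi * α / 2 -
        Real.pi * α * Real.exp (lowerNum α β h n * h) / (2 * L)) / α ≤
      Real.exp (Real.pi * max α β / 2) / min α β *
        Real.exp (-(Real.pi * min α β * Real.exp (n * h) / (2 * L))) := by
  have hmin := min_mul_exp_le_mul_exp_lowerNum (n := n) hα hβ hh
  rw [div_mul_eq_mul_div, ← Real.exp_add, ← sub_eq_add_neg, mul_assoc _ α, mul_assoc _ (min α β)]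
  gcongr
  · exact le_max_left α β
  · exact min_le_left α β

end Truncation

section Rate

theorem isLittleO_exp_neg_div_log {r a b : ℝ} (hr : 0 < r) (ha : 0 < a) (hab : a < b) :
    (fun x : ℝ => Real.exp (-(r * x / Real.log (a * x)))) =o[atTop]
      fun x => Real.exp (-(r * x / Real.log (b * x))) := by
  have hb : 0 < b := ha.trans hab
  have hlog : 0 < Real.log (b / a) := Real.log_pos ((one_lt_div ha).2 hab)
  rw [Real.isLittleO_exp_comp_exp_comp]
  have hquot : Tendsto (fun u : ℝ => u / Real.log u ^ 2) atTop atTop :=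
    ((Real.tendsto_exp_div_pow_atTop 2).comp Real.tendsto_log_atTop).congr' (by
      filter_upwards [eventually_gt_atTop 0] with u hu
      rw [Function.comp_apply, Real.exp_log hu])
  refine tendsto_atTop_mono' _ ?_ ((hquot.comp (tendsto_id.const_mul_atTop hb)).const_mul_atTop
    (show 0 < r * Real.log (b / a) / b by positivity))
  filter_upwards [eventually_gt_atTop a⁻¹] with x hx
  have hx0 : 0 < x := (inv_pos.2 ha).trans hx
  have hA : 0 < Real.log (a * x) := Real.log_pos ((inv_lt_iff_one_lt_mul₀' ha).1 hx)
  have hAB : Real.log (a * x) ≤ Real.log (b * x) := Real.log_le_log (by positivity) (by gcongr)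
  have hB : 0 < Real.log (b * x) := hA.trans_le hAB
  have hsub : Real.log (b / a) = Real.log (b * x) - Real.log (a * x) := by
    rw [← Real.log_div (by positivity) (by positivity), mul_div_mul_right _ _ hx0.ne']
  calc r * Real.log (b / a) / b * (b * x / Real.log (b * x) ^ 2)
      = r * x * Real.log (b / a) / (Real.log (b * x) * Real.log (b * x)) := by field_simp
    _ ≤ r * x * Real.log (b / a) / (Real.log (a * x) * Real.log (b * x)) := by gcongr
    _ = -(r * x / Real.log (b * x)) - -(r * x / Real.log (a * x)) := by
        rw [hsub]
        generalize Real.log (b * x) = B at *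
        generalize Real.log (a * x) = A at *
        field_simp
        ring

theorem exp_one_le_div_log {x : ℝ} (hx : 1 < x) : Real.exp 1 ≤ x / Real.log x := by
  have h := Real.exp_one_mul_le_exp (x := Real.log x)
  rwa [Real.exp_log (zero_lt_one.trans hx), ← le_div_iff₀ (Real.log_pos hx)] at h

end Rate

section ErrorBound

variable {f : ℂ → ℂ} {K α β d μ : ℝ} {n : ℕ}

theorem one_le_log_of_max_mul_exp_one_div_le {x : ℝ} (hα : 0 < α) (hβ : 0 < β) (hd : 0 < d)
    (hx : max α β * Real.exp 1 / (4 * d) ≤ x) : 1 ≤ Real.log (4 * d * x / min α β) := by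
  have hμ : 0 < min α β := lt_min hα hβ
  have hexp : Real.exp 1 ≤ 4 * d * x / min α β := by
    rw [le_div_iff₀ hμ, mul_comm]
    calc min α β * Real.exp 1 ≤ max α β * Real.exp 1 := by gcongr; exact min_le_max
      _ ≤ 4 * d * x := (div_le_iff₀' (by positivity)).1 hx
  exact (Real.le_log_iff_exp_le ((Real.exp_pos 1).trans_le hexp)).2 hexp

theorem pi_mul_mul_exp_one_div_two_le {x : ℝ} (hμ : 0 < μ) (hx : 1 < 4 * d * x / μ) :
    Real.pi * μ * Real.exp 1 / 2 ≤ 2 * Real.pi * d * x / Real.log (4 * d * x / μ) :=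
  calc Real.pi * μ * Real.exp 1 / 2 = Real.pi * μ / 2 * Real.exp 1 := by ring
    _ ≤ Real.pi * μ / 2 * (4 * d * x / μ / Real.log (4 * d * x / μ)) := by
        gcongr
        exact exp_one_le_div_log hx
    _ = 2 * Real.pi * d * x / Real.log (4 * d * x / μ) := by
        generalize Real.log (4 * d * x / μ) = L
        field_simp
        ring

theorem add_le_errorConst_mul {E : ℝ} (hK : 0 ≤ K) (hα : 0 < α) (hβ : 0 < β)
    (hd : |d| < Real.pi / 2) (hE : 0 ≤ E)
    (hE1 : E ≤ Real.exp (-(Real.pi * min α β * Real.exp 1 / 2))) :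
    4 * K * cTilde d ^ (1 - α) /
          (min α β * Real.cos (Real.pi / 2 * Real.sin d) ^ (α + β) * Real.cos d) *
        (E / (1 - E)) +
      2 * (K * Real.exp (Real.pi * (1 - α) / 12) *
        (Real.exp (Real.pi * max α β / 2) / min α β * E)) ≤ errorConst K α β d * E := by
  have hcos : 0 < Real.cos d := Real.cos_pos_of_mem_Ioo (abs_lt.1 hd)
  have hcos' := cos_pi_div_two_mul_sin_pos hd
  have hcTilde := cTilde_pos hd
  have hexp : Real.exp (Real.pi * (1 - α + 6 * max α β) / 12) =
      Real.exp (Real.pi * (1 - α) / 12) * Real.exp (Real.pi * max α β / 2) := by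
    rw [← Real.exp_add]
    ring_nf
  rw [errorConst, hexp]
  set q := Real.exp (-(Real.pi * min α β * Real.exp 1 / 2))
  have hq : 0 < 1 - q := sub_pos.2 (Real.exp_lt_one_iff.2 (neg_neg_of_pos (by positivity)))
  calc _ ≤ 4 * K * cTilde d ^ (1 - α) /
          (min α β * Real.cos (Real.pi / 2 * Real.sin d) ^ (α + β) * Real.cos d) *
        (E / (1 - q)) +
      2 * (K * Real.exp (Real.pi * (1 - α) / 12) *
        (Real.exp (Real.pi * max α β / 2) / min α β * E)) := by gcongr
    _ = _ := by
        field_simp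
        ring

theorem norm_tsum_deIntegrand_sub_sum_lowerNum_upperNum_le (hK : 0 ≤ K) (hα : 0 < α) (hα1 : α ≤ 1)
    (hβ : 0 < β) (hbound : ∀ x : ℝ, ‖f (psi x)‖ ≤ K * ‖E3 α β (psi x)‖) {h : ℝ} (hh : 0 < h)
    (hL : 1 ≤ n * h) (hM : xThreshold α ≤ lowerNum α β h n * h)
    (hN : xThreshold β ≤ upperNum α β h n * h) :
    ‖h * ∑' k : ℤ, deIntegrand f ((k * h : ℝ) : ℂ) -
        h * ∑ k ∈ Finset.Icc (-lowerNum α β h n) (upperNum α β h n),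
          deIntegrand f ((k * h : ℝ) : ℂ)‖ ≤
      2 * (K * Real.exp (Real.pi * (1 - α) / 12) * (Real.exp (Real.pi * max α β / 2) / min α β *
        Real.exp (-(Real.pi * min α β * Real.exp (n * h) / (2 * (n * h)))))) := by
  have hL0 := zero_le_one.trans hL
  rw [upperNum_eq_lowerNum] at hN ⊢
  refine (norm_tsum_deIntegrand_sub_sum_le hK hα hα1 hβ hbound hh hL hM
    (lowerNum_mul_le hβ hh.le) hN (lowerNum_mul_le hα hh.le)).trans ?_
  have hlower := exp_sub_mul_exp_lowerNum_le (n := n) hα hβ hh hL0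
  have hupper := exp_sub_mul_exp_lowerNum_le (n := n) hβ hα hh hL0
  rw [max_comm, min_comm] at hupper
  grw [hlower, hupper, ← two_mul]

theorem norm_integral_deIntegrand_sub_sum_le (hd0 : 0 < d) (hd : d < Real.pi / 2) (hK : 0 ≤ K)
    (hα : 0 < α) (hα1 : α ≤ 1) (hβ : 0 < β) (hf : DifferentiableOn ℂ f (psi '' strip d))
    (hbound : ∀ z ∈ psi '' strip d, ‖f z‖ ≤ K * ‖E3 α β z‖) {h : ℝ}
    (hh : h = mesh d (min α β) n) (hn : max α β * Real.exp 1 / (4 * d) ≤ n)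
    (hM : xThreshold α ≤ lowerNum α β h n * h) (hN : xThreshold β ≤ upperNum α β h n * h) :
    ‖(∫ t : ℝ, deIntegrand f t) -
        h * ∑ k ∈ Finset.Icc (-lowerNum α β h n) (upperNum α β h n),
          deIntegrand f ((k * h : ℝ) : ℂ)‖ ≤
      errorConst K α β d *
        Real.exp (-(2 * Real.pi * d * n / Real.log (4 * d * n / min α β))) := by
  have hμ : 0 < min α β := lt_min hα hβ
  have hn0 : 0 < (n : ℝ) := hn.trans_lt' (by positivity)
  have hx : 0 < 4 * d * n / min α β := by positivity
  have hL := one_le_log_of_max_mul_exp_one_div_le hα hβ hd0 hn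
  have hrate := pi_mul_mul_exp_one_div_two_le hμ
    ((Real.log_pos_iff hx.le).1 (zero_lt_one.trans_le hL))
  have hexpL := Real.exp_log hx
  rw [mesh] at hh
  set L := Real.log (4 * d * n / min α β)
  have hh0 : 0 < h := hh ▸ div_pos (zero_lt_one.trans_le hL) hn0
  have hnh : n * h = L := by rw [hh, mul_div_cancel₀ _ hn0.ne']
  have hstrip : 2 * Real.pi * d / h = 2 * Real.pi * d * n / L := by rw [hh, div_div_eq_mul_div]
  have hexponent : Real.pi * min α β * Real.exp (n * h) / (2 * (n * h)) =
      2 * Real.pi * d * n / L := by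
    rw [hnh, hexpL]
    field_simp
    ring
  refine (norm_sub_le_norm_sub_add_norm_sub _ (h * ∑' k : ℤ, deIntegrand f ((k * h : ℝ) : ℂ))
    _).trans ?_
  grw [norm_integral_deIntegrand_sub_tsum_le hd0 hd hK hα hα1 hβ hf hbound hh0,
    norm_tsum_deIntegrand_sub_sum_lowerNum_upperNum_le hK hα hα1 hβ
      (fun x => hbound _ ⟨x, ofReal_mem_strip hd0 x, rfl⟩) hh0 (hnh ▸ hL) hM hN,
    hstrip, hexponent]
  exact add_le_errorConst_mul hK hα hβ (abs_lt.2 ⟨by linarith, hd⟩) (Real.exp_pos _).le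
    (Real.exp_le_exp.2 (neg_le_neg hrate))

end ErrorBound

end SincDE

theorem theorem2p11 (d : ℝ) (hd0 : 0 < d) (hd : d < Real.pi / 2)
    (K α β : ℝ) (hK : 0 < K) (hα : 0 < α) (hα1 : α ≤ 1) (hβ : 0 < β)
    (f : ℂ → ℂ)
    (hf : AnalyticOnNhd ℂ f (SincDE.psi '' SincDE.strip d))
    (hbound : ∀ z ∈ SincDE.psi '' SincDE.strip d, ‖f z‖ ≤ K * ‖SincDE.E3 α β z‖) :
    MeasureTheory.IntegrableOn (fun t : ℝ => f (t : ℂ)) (Set.Ioi 0) ∧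
    (∀ (n : ℕ) (μ ν h : ℝ) (M N : ℤ),
      μ = min α β → ν = max α β →
      h = SincDE.mesh d μ n →
      M = SincDE.lowerNum α β h n → N = SincDE.upperNum α β h n →
      ν * Real.exp 1 / (4 * d) ≤ n →
      SincDE.xThreshold α ≤ M * h → SincDE.xThreshold β ≤ N * h →
      ‖(∫ t in Set.Ioi (0 : ℝ), f (t : ℂ)) -
          (h : ℂ) * ∑ k ∈ Finset.Icc (-M) N,
            f (SincDE.psi ((k * h : ℝ) : ℂ)) * deriv SincDE.psi ((k * h : ℝ) : ℂ)‖
        ≤ SincDE.errorConst K α β d *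
            Real.exp (-(2 * Real.pi * d * n / Real.log (4 * d * n / μ)))) ∧
    (∀ c : ℝ, c = 8 ∨ c = 2 * Real.pi →
      (fun n : ℕ => Real.exp (-(2 * Real.pi * d * n / Real.log (4 * d * n / min α β))))
        =o[Filter.atTop]
      (fun n : ℕ => Real.exp (-(2 * Real.pi * d * n / Real.log (c * d * n / min α β))))) := by
  refine ⟨?_, ?_, ?_⟩
  · exact SincDE.integrableOn_Ioi_iff_integrable_deIntegrand.2 <|
      SincDE.integrable_deIntegrand hd0 hd hK.le hα hα1 hβ
        (SincDE.differentiableOn_deIntegrand hd.le hf.differentiableOn).continuousOn hbound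
  · rintro n _ _ h _ _ rfl rfl hh rfl rfl hn hM hN
    rw [SincDE.integral_Ioi_eq_integral_deIntegrand]
    exact SincDE.norm_integral_deIntegrand_sub_sum_le hd0 hd hK.le hα hα1 hβ hf.differentiableOn
      hbound hh hn hM hN
  · intro c hc
    have hc4 : 4 < c := by rcases hc with rfl | rfl <;> linarith [Real.pi_gt_three]
    have hab : 4 * d / min α β < c * d / min α β := by gcongr
    simpa only [Function.comp_def, div_mul_eq_mul_div] using
      (SincDE.isLittleO_exp_neg_div_log (r := 2 * Real.pi * d) (by positivity) (by positivity)
        hab).comp_tendsto tendsto_natCast_atTop_atTop
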